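/- Let $\Omega=\{\omega\in C([0,1],\mathbb R^d):\omega(0)=0\}$ with canonical process $B$ and raw filtration $\mathbb F=(\mathcal F_t)_{0\le t\le 1}$, $\mathcal F_t=\sigma(B_s,s\le t)$. Let $\underline a\le\overline a$ be symmetric $d\times d$ matrices with $\underline a\ge 0$ and $\overline a>0$ (positive definite). For a symmetric matrix $A=\sum_k\lambda_k\,\nu_k\otimes\nu_k$ (orthonormal eigenvectors $\nu_k$) put $A\vee cI_d=\sum_k(\lambda_k\vee c)\,\nu_k\otimes\nu_k$. Let $\mathcal P$ be the set of probability measures $\mathbb P$ on $(\Omega,\mathcal F_1)$ under which $B$ is a martingale whose quadratic variation is absolutely continuous and satisfies, for some constant $c=c(\mathbb P)>0$, $$ \underline a\vee cI_d\ \le\ \frac{d\langle B\rangle_t}{dt}\ \le\ \overline a\qquad \text{for a.e. } t\in[0,1],\ \mathbb P\text{-a.s.} $$ A property holds quasi-surely if it holds $\mathbb P$-a.s. for every $\mathbb P\in\mathcal P$. For an $\mathbb R^d$-valued integrand $H$ and a real process $Y$ put $$\|H\|_{\mathbb H^2_{\mathcal P}}^2=\sup_{\mathbb P\in\mathcal P}\mathbb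 E^{\mathbb P}\Big[\int_0^1 d\langle B\rangle_tH_t\cdot H_t\Big],\qquad \|Y\|_{\mathbb S^2_{\mathcal P}}^2=\sup_{\mathbb P\in\mathcal P}\mathbb E^{\mathbb P}\Big[\operatorname*{ess\,sup}_{0\le t\le 1}|Y_t|^2\Big]$$ (with $\sup\emptyset=0$). Let $\mathbb H^2_{\mathcal P}$ be the set of $\mathbb F$-progressively measurable $H$ with $\|H\|_{\mathbb H^2_{\mathcal P}}<\infty$, and $\mathbb I^2_{\mathcal P}$ the set of $\mathbb F$-progressively measurable $K$ with $\|K\|_{\mathbb S^2_{\mathcal P}}<\infty$ that quasi-surely are continuous and non-decreasing with $K_0=0$. For $(H,K)\in\mathbb H^2_{\mathcal P}\times\mathbb I^2_{\mathcal P}$ and a constant $M_0\in\mathbb R$, let $$ M_t=M_0+\int_0^tH_s\,dB_s-K_t,\qquad 0\le t\le 1, $$ where the Itô integral, and hence $M=M^{\mathbb P}$, is taken under each $\mathbb P\in\mathcal P$; in $\|M\|_{\mathbb S^2_{\mathcal P}}$ the expectation under $\mathbb P$ is that of $M^{\mathbb P}$. **Proposition.** There is a constant $C$ depending only on the dimension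 $d$ such that the following hold for all such $\underline a,\overline a$. (One process.) If $M$ is given as above by $M_0\in\mathbb R$ and $(H,K)\in\mathbb H^2_{\mathcal P}\times\mathbb I^2_{\mathcal P}$, then $$\|H\|_{\mathbb H^2_{\mathcal P}}+\|K\|_{\mathbb S^2_{\mathcal P}}\le C\,\|M\|_{\mathbb S^2_{\mathcal P}} .$$ (Differences.) If $M^i$ is given as above by $M^i_0\in\mathbb R$ and $(H^i,K^i)\in\mathbb H^2_{\mathcal P}\times\mathbb I^2_{\mathcal P}$ for $i=1,2$, and $\delta M=M^1-M^2$, $\delta H=H^1-H^2$, $\delta K=K^1-K^2$, then $$\|\delta H\|^2_{\mathbb H^2_{\mathcal P}}+\|\delta K\|^2_{\mathbb S^2_{\mathcal P}}\le C\Big[\|\delta M\|^2_{\mathbb S^2_{\mathcal P}}+\|\delta M\|_{\mathbb S^2_{\mathcal P}}\big(\|K^1\|_{\mathbb S^2_{\mathcal P}}+\|K^2\|_{\mathbb S^2_{\mathcal P}}\big)\Big].$$ -/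

import Mathlib

open MeasureTheory Filter Topology
open scoped ENNReal NNReal Matrix unitInterval

noncomputable section

namespace GMart

/-- The canonical space `Ω = {ω ∈ C([0,1], ℝ^d) : ω 0 = 0}`. (Only the topology of `ℝ^d` matters in
what follows, so `ℝ^d` is `Fin d → ℝ`.) -/
def PathSpace (d : ℕ) : Type := {ω : C(I, Fin d → ℝ) // ω 0 = 0}

/-- The canonical process `B`. -/
def B {d : ℕ} (t : I) (ω : PathSpace d) : Fin d → ℝ := ω.1 t

/-- The σ-algebra on `Ω` is the one generated by the canonical process. -/
instance (d : ℕ) : MeasurableSpace (PathSpace d) :=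
  ⨆ t : I, MeasurableSpace.comap (B t) inferInstance

/-- The raw (not augmented) filtration `F_t = σ(B_s, s ≤ t)`, `t ∈ [0,1]`. -/
def canonicalFiltration (d : ℕ) :
    Filtration I (inferInstance : MeasurableSpace (PathSpace d)) where
  seq t := ⨆ s : I, ⨆ _ : s ≤ t, MeasurableSpace.comap (B s) inferInstance
  mono' _ _ h := iSup_mono fun _ => iSup_mono' fun hs => ⟨hs.trans h, le_rfl⟩
  le' _ := iSup_mono fun _ => iSup_le fun _ => le_rfl

/-- `F`-progressive measurability of a real process. -/
def IsProgressive {d : ℕ} (Y : I → PathSpace d → ℝ) : Prop :=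
  IsStronglyProgressive (canonicalFiltration d) Y

/-- `F`-progressive measurability of an `ℝ^d`-valued process. -/
def IsProgressiveVec {d : ℕ} (H : I → PathSpace d → Fin d → ℝ) : Prop :=
  IsStronglyProgressive (canonicalFiltration d) H

/-- `a` is (a progressively measurable version of) the density `d⟨B⟩_t/dt` under `P`:
`⟨B⟩_t = ∫_0^t a_s ds` is the absolutely continuous, adapted, matrix-valued process, null at `0`,
that makes `B ⊗ B - ⟨B⟩` a martingale. Such an `a` is unique `dt × P`-almost everywhere. -/
structure IsQuadVarDensity {d : ℕ} (P : Measure (PathSpace d))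
    (a : I → PathSpace d → Matrix (Fin d) (Fin d) ℝ) : Prop where
  progressive : ∀ i j, IsProgressive fun t ω => a t ω i j
  integrable : ∀ᵐ ω ∂P, ∀ i j, Integrable (fun t => a t ω i j) (volume : Measure I)
  martingale : ∀ i j, Martingale
    (fun t ω => B t ω i * B t ω j - ∫ s in Set.Iic t, a s ω i j) (canonicalFiltration d) P

open Classical in
/-- The density `d⟨B⟩_t/dt` of the quadratic variation of the canonical process under `P`
(zero if there is none). -/
def quadVarDensity {d : ℕ} (P : Measure (PathSpace d)) :
    I → PathSpace d → Matrix (Fin d) (Fin d) ℝ :=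
  if h : ∃ a, IsQuadVarDensity P a then h.choose else 0

/-- `A ∨ c I_d = ∑ k, (λ_k ∨ c) ν_k ⊗ ν_k`, with `λ_k`, `ν_k` the eigenvalues and the orthonormal
eigenvectors of the symmetric matrix `A`. -/
def maxScalar {d : ℕ} {A : Matrix (Fin d) (Fin d) ℝ} (hA : A.IsHermitian) (c : ℝ) :
    Matrix (Fin d) (Fin d) ℝ :=
  ∑ k, max (hA.eigenvalues k) c •
    Matrix.vecMulVec (hA.eigenvectorBasis k).ofLp (hA.eigenvectorBasis k).ofLp

/-- The bounds `0 ≤ a_low ≤ a_up`, `a_up > 0`, on the volatility. -/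
structure VolBounds (d : ℕ) where
  low : Matrix (Fin d) (Fin d) ℝ
  up : Matrix (Fin d) (Fin d) ℝ
  low_nonneg : low.PosSemidef
  up_pos : up.PosDef
  low_le_up : (up - low).PosSemidef

/-- The set `𝒫` of probability measures under which `B` is a martingale with an absolutely
continuous quadratic variation whose density lies between `c I_d ∨ a_low` and `a_up`, for
some `c > 0` that may depend on the measure. -/
def measureClass {d : ℕ} (a : VolBounds d) : Set (Measure (PathSpace d)) :=
  {P | IsProbabilityMeasure P ∧ Martingale B (canonicalFiltration d) P ∧
    IsQuadVarDensity P (quadVarDensity P) ∧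
    ∃ c : ℝ, 0 < c ∧ ∀ᵐ ω ∂P, ∀ᵐ t : I,
      (quadVarDensity P t ω - maxScalar a.low_nonneg.isHermitian c).PosSemidef ∧
      (a.up - quadVarDensity P t ω).PosSemidef}

/-- The energy `∫_0^1 d⟨B⟩_t H_t · H_t` along a path, with `⟨B⟩` taken under `P`. -/
def energy {d : ℕ} (P : Measure (PathSpace d)) (H : I → PathSpace d → Fin d → ℝ)
    (ω : PathSpace d) : ℝ≥0∞ :=
  ∫⁻ t : I, ENNReal.ofReal ((quadVarDensity P t ω *ᵥ H t ω) ⬝ᵥ H t ω)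

/-- `‖H‖_{ℍ^p_𝒫} = (sup_{P ∈ 𝒫} E^P[(∫_0^1 d⟨B⟩_t H_t · H_t)^{p/2}])^{1/p}`. -/
def hNorm {d : ℕ} (a : VolBounds d) (p : ℝ) (H : I → PathSpace d → Fin d → ℝ) : ℝ≥0∞ :=
  (⨆ P ∈ measureClass a, ∫⁻ ω, energy P H ω ^ (p / 2) ∂P) ^ (1 / p)

/-- `‖Y‖_{𝕊^p_𝒫} = (sup_{P ∈ 𝒫} E^P[ess sup_t |Y_t|^p])^{1/p}`, for a family `Y = (Y^P)_P` of
processes, each considered under its own measure. -/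
def sNormFam {d : ℕ} (a : VolBounds d) (p : ℝ)
    (Y : Measure (PathSpace d) → I → PathSpace d → ℝ) : ℝ≥0∞ :=
  (⨆ P ∈ measureClass a, ∫⁻ ω, essSup (fun t : I => ‖Y P t ω‖ₑ ^ p) volume ∂P) ^ (1 / p)

/-- `‖Y‖_{𝕊^p_𝒫}` for one process `Y`. -/
def sNorm {d : ℕ} (a : VolBounds d) (p : ℝ) (Y : I → PathSpace d → ℝ) : ℝ≥0∞ :=
  sNormFam a p fun _ => Y

/-- `H ∈ ℍ^p_𝒫`. -/
structure MemH {d : ℕ} (a : VolBounds d) (p : ℝ) (H : I → PathSpace d → Fin d → ℝ) : Prop where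
  progressive : IsProgressiveVec H
  norm_lt_top : hNorm a p H < ∞

/-- `Y ∈ 𝕊^p_𝒫`. -/
structure MemS {d : ℕ} (a : VolBounds d) (p : ℝ) (Y : I → PathSpace d → ℝ) : Prop where
  progressive : IsProgressive Y
  continuous : ∀ P ∈ measureClass a, ∀ᵐ ω ∂P, Continuous fun t => Y t ω
  norm_lt_top : sNorm a p Y < ∞

/-- `K ∈ 𝕀^p_𝒫`. -/
structure MemI {d : ℕ} (a : VolBounds d) (p : ℝ) (K : I → PathSpace d → ℝ) : Prop
    extends MemS a p K where
  monotone : ∀ P ∈ measureClass a, ∀ᵐ ω ∂P, Monotone fun t => K t ω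
  zero : ∀ P ∈ measureClass a, ∀ᵐ ω ∂P, K 0 ω = 0

/-- A simple integrand `∑_{i < n} ξ_i 1_{[t_i, t_{i+1})}` with `ξ_i` bounded and
`F_{t_i}`-measurable. -/
structure SimpleIntegrand (d : ℕ) where
  n : ℕ
  time : ℕ → I
  time_mono : Monotone time
  coeff : ℕ → PathSpace d → Fin d → ℝ
  coeff_meas : ∀ i, StronglyMeasurable[canonicalFiltration d (time i)] (coeff i)
  coeff_bdd : ∃ R : ℝ, ∀ i ω k, |coeff i ω k| ≤ R

/-- The simple integrand as a process. -/
def SimpleIntegrand.value {d : ℕ} (S : SimpleIntegrand d) (t : I) (ω : PathSpace d) :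
    Fin d → ℝ :=
  ∑ i ∈ Finset.range S.n,
    (Set.Ico (S.time i) (S.time (i + 1))).indicator (fun _ => S.coeff i ω) t

/-- Its pathwise stochastic integral `∑_{i < n} ξ_i · (B_{t ∧ t_{i+1}} - B_{t ∧ t_i})`. -/
def SimpleIntegrand.integral {d : ℕ} (S : SimpleIntegrand d) (t : I) (ω : PathSpace d) : ℝ :=
  ∑ i ∈ Finset.range S.n,
    S.coeff i ω ⬝ᵥ (B (min t (S.time (i + 1))) ω - B (min t (S.time i)) ω)

/-- `X` is (a progressively measurable, almost surely continuous version of) the Itô integral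
`∫_0^· H_s dB_s` under `P`: the limit, in `L²(P)` uniformly in time, of the integrals of simple
integrands that converge to `H` in the energy norm `E^P[∫_0^1 d⟨B⟩_t H_t · H_t]`. -/
structure IsItoIntegral {d : ℕ} (P : Measure (PathSpace d)) (H : I → PathSpace d → Fin d → ℝ)
    (X : I → PathSpace d → ℝ) : Prop where
  progressive : IsProgressive X
  continuous : ∀ᵐ ω ∂P, Continuous fun t => X t ω
  approx : ∃ S : ℕ → SimpleIntegrand d,
    Tendsto (fun n => ∫⁻ ω, energy P ((S n).value - H) ω ∂P) atTop (𝓝 0) ∧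
    Tendsto (fun n => ∫⁻ ω, (⨆ t : I, ‖(S n).integral t ω - X t ω‖ₑ) ^ 2 ∂P) atTop (𝓝 0)

/-- `M_t = m + ∫_0^t H_s dB_s - K_t` for all `t ∈ [0,1]`, `P`-a.s. for every `P ∈ 𝒫`. For a general
`H ∈ ℍ²_𝒫` the stochastic integral is defined under each `P` separately, so `M = (M^P)_P` is a
family; a process `M` that is defined for all `P` at once is the constant family.
The initial value is a real number since `F_0` is trivial. -/
def IsDecomposition {d : ℕ} (a : VolBounds d) (M : Measure (PathSpace d) → I → PathSpace d → ℝ)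
    (m : ℝ) (H : I → PathSpace d → Fin d → ℝ) (K : I → PathSpace d → ℝ) : Prop :=
  ∀ P ∈ measureClass a, ∃ X, IsItoIntegral P H X ∧
    ∀ᵐ ω ∂P, ∀ t, M P t ω = m + X t ω - K t ω

end GMart

end

/-! Fix `P ∈ 𝒫` and write `N = m + X - k`, where `X` is the Itô integral of `H`, `k = K₁ - K₂` and
`Z = max_t |N_t|`; the one-process case is `K₂ = 0`. Let `h` be the energy norm of `H` and `s` the
`L²` norm of `Z`.

Energy bound. Since `k` is continuous, of finite variation and null at `0`, `(m + X_1)² = N_1² + 2 ∫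
N dk + 2 ∫ (X_1 - X_t) dk_t`, and the last term has mean zero. As `|dk| ≤ dK₁ + dK₂`, this gives
`E[X_1²] ≤ E[Z²] + 2 E[Z (K₁ 1 + K₂ 1)]`. Itô's formula is not needed: on a grid the identity is
exact up to the squared increments of `k`, whose sum tends to `0` (`sq_le_of_decomposition`,
`ItoApprox.integral_sq_le`). The isometry `ItoApprox.energyNorm_eq` and Cauchy–Schwarz turn it into
`h² ≤ s² + 2 s (‖K₁ 1‖ + ‖K₂ 1‖)`.

Maximal bound. From `k = m + X - N`, `m = N_0` and Doob's inequality
(`ItoApprox.eLpNorm_maximal_le`), the `L²` norm of `max |k|` is at most `2 s + 2 h`.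

For one process, `‖K 1‖ ≤ 2 s + 2 h` closes the loop: `h² ≤ 5 s² + 4 s h`, that is `(h - 5 s)(h + s)
≤ 0`, so `h ≤ 5 s`. For differences no such absorption is possible, because the energy bound
involves the sum `K₁ 1 + K₂ 1` and not `k`; the two bounds are simply combined. The constants do not
depend on `P`, the matrices or `d`, so the supremum over `𝒫` can be taken at the end. -/

theorem MeasureTheory.Martingale.integral_mul_sub_eq_zero {Ω ι : Type*} [Preorder ι]
    {m0 : MeasurableSpace Ω} {μ : Measure Ω} [IsFiniteMeasure μ] {ℱ : Filtration ι m0}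
    {X : ι → Ω → ℝ} (hX : Martingale X ℱ μ) {s t : ι} (hst : s ≤ t) {Y : Ω → ℝ}
    (hY : StronglyMeasurable[ℱ s] Y) (hint : Integrable (fun ω => Y ω * (X t ω - X s ω)) μ) :
    ∫ ω, Y ω * (X t ω - X s ω) ∂μ = 0 := by
  have h1 : μ[Y * (X t - X s) | ℱ s] =ᵐ[μ] Y * μ[X t - X s | ℱ s] :=
    condExp_mul_of_stronglyMeasurable_left hY hint ((hX.integrable t).sub (hX.integrable s))
  have h2 : μ[X t - X s | ℱ s] =ᵐ[μ] 0 := by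
    refine (condExp_sub (hX.integrable t) (hX.integrable s) _).trans ?_
    filter_upwards [hX.condExp_ae_eq hst, hX.condExp_ae_eq (le_refl s)] with ω h h'
    simp [h, h']
  have h3 : μ[Y * (X t - X s) | ℱ s] =ᵐ[μ] 0 := by
    filter_upwards [h1, h2] with ω h h'
    simp [h, h']
  have h4 := integral_condExp (μ := μ) (f := Y * (X t - X s)) (ℱ.le s)
  rw [integral_congr_ae h3] at h4
  simpa using h4.symm

/-! ### The canonical process and the working properties of the measures in `𝒫`. -/

namespace GMart

variable {d : ℕ}

theorem measurable_B (t : I) : Measurable (B t : PathSpace d → Fin d → ℝ) :=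
  Measurable.mono (comap_measurable _)
    (le_iSup (fun t : I => MeasurableSpace.comap (B t) _) t) le_rfl

theorem measurable_B_apply (t : I) (k : Fin d) : Measurable fun ω : PathSpace d => B t ω k :=
  (measurable_pi_apply k).comp (measurable_B t)

theorem stronglyMeasurable_B_apply {s t : I} (h : s ≤ t) (k : Fin d) :
    StronglyMeasurable[canonicalFiltration d t] fun ω : PathSpace d => B s ω k := by
  refine Measurable.stronglyMeasurable ?_
  refine (measurable_pi_apply k).comp ?_
  exact Measurable.mono (comap_measurable _) (le_iSup₂_of_le s h le_rfl) le_rfl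

theorem martingale_B_apply {P : Measure (PathSpace d)}
    (hB : Martingale B (canonicalFiltration d) P) (k : Fin d) :
    Martingale (fun t ω => B t ω k) (canonicalFiltration d) P := by
  refine ⟨fun t => stronglyMeasurable_B_apply le_rfl k, fun s t hst => ?_⟩
  have h := (ContinuousLinearMap.proj (R := ℝ) (φ := fun _ : Fin d => ℝ) k).comp_condExp_comm
    (m := canonicalFiltration d s) (hB.integrable t)
  refine EventuallyEq.trans h.symm ?_
  filter_upwards [hB.condExp_ae_eq hst] with ω hω
  simp [hω]

/-- A progressively measurable process is jointly measurable. -/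
theorem measurable_uncurry_of_progressive {E : Type*} [TopologicalSpace E]
    {Y : I → PathSpace d → E} (hY : IsStronglyProgressive (canonicalFiltration d) Y) :
    StronglyMeasurable fun p : PathSpace d × I => Y p.2 p.1 := by
  have h := hY (1 : I)
  have hm : Measurable[Prod.instMeasurableSpace,
      @Prod.instMeasurableSpace _ _ _ (canonicalFiltration d 1)]
      (fun p : PathSpace d × I => ((⟨p.2, p.2.2.2⟩ : Set.Iic (1 : I)), p.1)) := by
    refine Measurable.prodMk (measurable_snd.subtype_mk) ?_
    exact measurable_fst.mono le_rfl ((canonicalFiltration d).le 1)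
  exact h.comp_measurable hm

/-- A nonempty open subset of `[0,1]` contains an interval of positive length. This makes the
essential supremum in the `𝕊²` norm a true maximum on continuous paths. -/
theorem le_essSup_of_continuous {f : I → ℝ≥0∞} (hf : Continuous f) (t : I) :
    f t ≤ essSup f (volume : Measure I) := by
  by_contra! hlt
  obtain ⟨u, v, huv, hsub⟩ := (isOpen_lt continuous_const hf).exists_Ioo_subset ⟨t, hlt⟩
  have h0 : (volume : Measure I) {x | ¬ f x ≤ essSup f (volume : Measure I)} = 0 :=
    ENNReal.ae_le_essSup f
  have h1 : (volume : Measure I) (Set.Ioo u v) = 0 :=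
    measure_mono_null (fun x hx => not_le.2 (hsub hx)) h0
  rw [unitInterval.volume_Ioo, ENNReal.ofReal_eq_zero] at h1
  exact absurd huv (not_lt.2 (by simpa using h1))

/-- The working properties of the elements of `measureClass`. -/
structure IsAdmissible (P : Measure (PathSpace d))
    (a : I → PathSpace d → Matrix (Fin d) (Fin d) ℝ) : Prop where
  prob : IsProbabilityMeasure P
  mart : Martingale B (canonicalFiltration d) P
  dens : IsQuadVarDensity P a
  psd : ∀ᵐ ω ∂P, ∀ᵐ t : I, (a t ω).PosSemidef
  bdd : ∃ C : ℝ, ∀ᵐ ω ∂P, ∀ᵐ t : I, ∀ k l, |a t ω k l| ≤ C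

theorem posSemidef_maxScalar {A : Matrix (Fin d) (Fin d) ℝ} (hA : A.IsHermitian) {c : ℝ}
    (hc : 0 ≤ c) : (maxScalar hA c).PosSemidef := by
  refine Matrix.posSemidef_sum _ fun k _ => ?_
  have := Matrix.posSemidef_vecMulVec_self_star (R := ℝ) ((hA.eigenvectorBasis k).ofLp)
  exact Matrix.PosSemidef.smul (by simpa using this) (le_max_of_le_right hc)

/-- Test the quadratic form on `e_k + e_l` and `e_k - e_l`. Entries of the density are thereby
controlled by its diagonal, hence by the diagonal of the upper bound. -/
theorem _root_.Matrix.PosSemidef.abs_apply_le {A : Matrix (Fin d) (Fin d) ℝ} (hA : A.PosSemidef)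
    (k l : Fin d) : |A k l| ≤ A k k + A l l := by
  have h (r : ℝ) (hr : r ^ 2 = 1) : 0 ≤ A k k + A l l + 2 * (r * A k l) := by
    have := hA.dotProduct_mulVec_nonneg (Pi.single k 1 + Pi.single l r)
    have hs : A l k = A k l := by simpa using hA.1.apply k l
    simp [Matrix.mulVec_add, add_dotProduct, Matrix.mulVec_single, hs, dotProduct_add] at this
    linear_combination this + A l l * hr
  have h1 := h 1 (by norm_num)
  have h2 := h (-1) (by norm_num)
  have hk := hA.diag_nonneg (i := k)
  have hl := hA.diag_nonneg (i := l)
  rw [abs_le]; constructor <;> linarith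

theorem isAdmissible_of_mem {a : VolBounds d} {P : Measure (PathSpace d)} (hP : P ∈ measureClass a) :
    IsAdmissible P (quadVarDensity P) := by
  obtain ⟨h1, h2, h3, c, hc, h4⟩ := hP
  have hpsd : ∀ᵐ ω ∂P, ∀ᵐ t : I, (quadVarDensity P t ω).PosSemidef := by
    filter_upwards [h4] with ω hω
    filter_upwards [hω] with t ht
    have := ht.1.add (posSemidef_maxScalar a.low_nonneg.isHermitian hc.le)
    simpa using this
  refine ⟨h1, h2, h3, hpsd, ∑ k, 2 * a.up k k, ?_⟩
  filter_upwards [h4, hpsd] with ω hω hω'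
  filter_upwards [hω, hω'] with t ht ht' k l
  have hd (i) : quadVarDensity P t ω i i ≤ a.up i i := by
    have := ht.2.diag_nonneg (i := i)
    simpa using this
  have hn (i) : 0 ≤ a.up i i := a.up_pos.posSemidef.diag_nonneg
  have hs (i) : a.up i i ≤ ∑ k, a.up k k :=
    Finset.single_le_sum (f := fun i => a.up i i) (fun i _ => hn i) (Finset.mem_univ i)
  have := ht'.abs_apply_le k l
  rw [← Finset.mul_sum]
  linarith [hd k, hd l, hs k, hs l]

end GMart

/-! ### Second moments of the increments of `B`. -/

theorem MeasureTheory.MemLp.bdd_mul_of_abs_le {Ω : Type*} {m0 : MeasurableSpace Ω} {μ : Measure Ω}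
    {f g : Ω → ℝ} {R : ℝ} {p : ℝ≥0∞} (hg : MemLp g p μ) (hf : AEStronglyMeasurable f μ)
    (hR : ∀ ω, |f ω| ≤ R) : MemLp (fun ω => f ω * g ω) p μ :=
  hg.mul (memLp_top_of_bound hf R (ae_of_all _ hR))

theorem MeasureTheory.MemLp.integrable_mul_two {Ω : Type*} {m0 : MeasurableSpace Ω} {μ : Measure Ω}
    {f g : Ω → ℝ} (hf : MemLp f 2 μ) (hg : MemLp g 2 μ) : Integrable (fun ω => f ω * g ω) μ :=
  hf.integrable_mul hg

namespace GMart

variable {d : ℕ} {P : Measure (PathSpace d)} {a : I → PathSpace d → Matrix (Fin d) (Fin d) ℝ}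

namespace IsAdmissible

theorem measurable_dens (h : IsAdmissible P a) (k l : Fin d) :
    Measurable fun p : PathSpace d × I => a p.2 p.1 k l :=
  (measurable_uncurry_of_progressive (h.dens.progressive k l)).measurable

theorem exists_bound (h : IsAdmissible P a) :
    ∃ C : ℝ, ∀ᵐ p ∂(P.prod (volume : Measure I)), ∀ k l, |a p.2 p.1 k l| ≤ C := by
  have := h.prob
  obtain ⟨C, hC⟩ := h.bdd
  refine ⟨C, (Measure.ae_prod_iff_ae_ae ?_).2 hC⟩
  simp only [Set.ofPred_forall]
  exact MeasurableSet.iInter fun k => MeasurableSet.iInter fun l =>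
    measurableSet_le (h.measurable_dens k l).abs measurable_const

theorem integrable_mul_dens (h : IsAdmissible P a) {f : PathSpace d × I → ℝ} (hf : Measurable f)
    {R : ℝ} (hR : ∀ p, |f p| ≤ R) (k l : Fin d) :
    Integrable (fun p => f p * a p.2 p.1 k l) (P.prod (volume : Measure I)) := by
  have := h.prob
  obtain ⟨C, hC⟩ := h.exists_bound
  refine Integrable.of_bound (hf.mul (h.measurable_dens k l)).aestronglyMeasurable (R * C) ?_
  filter_upwards [hC] with p hp
  rw [Real.norm_eq_abs, abs_mul]
  exact mul_le_mul (hR p) (hp k l) (abs_nonneg _) ((abs_nonneg _).trans (hR p))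

theorem integrable_setIntegral_dens (h : IsAdmissible P a) (t : I) (k l : Fin d) :
    Integrable (fun ω => ∫ s in Set.Iic t, a s ω k l) P := by
  have := h.prob
  have h1 := h.integrable_mul_dens (f := fun p => (Set.Iic t).indicator (fun _ => (1 : ℝ)) p.2)
    ((measurable_const.indicator measurableSet_Iic).comp measurable_snd) (R := 1)
    (fun p => by by_cases hp : p.2 ∈ Set.Iic t <;> simp [hp]) k l
  refine h1.integral_prod_left.congr (ae_of_all _ fun ω => ?_)
  simp only
  rw [← integral_indicator measurableSet_Iic]
  congr 1 with s
  by_cases hs : s ∈ Set.Iic t <;> simp [hs]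

theorem integrable_B_mul_B (h : IsAdmissible P a) (t : I) (k l : Fin d) :
    Integrable (fun ω => B t ω k * B t ω l) P := by
  refine (((h.dens.martingale k l).integrable t).add
    (h.integrable_setIntegral_dens t k l)).congr (ae_of_all _ fun ω => ?_)
  simp

theorem memLp_B (h : IsAdmissible P a) (t : I) (k : Fin d) : MemLp (fun ω => B t ω k) 2 P := by
  rw [memLp_two_iff_integrable_sq (measurable_B_apply t k).aestronglyMeasurable]
  simpa only [sq] using h.integrable_B_mul_B t k k

theorem integral_mul_sub_B (h : IsAdmissible P a) {s t : I} (hst : s ≤ t) {Y : PathSpace d → ℝ}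
    (hY : StronglyMeasurable[canonicalFiltration d s] Y) (hY2 : MemLp Y 2 P) (k : Fin d) :
    ∫ ω, Y ω * (B t ω k - B s ω k) ∂P = 0 := by
  have := h.prob
  exact (martingale_B_apply h.mart k).integral_mul_sub_eq_zero hst hY
    (hY2.integrable_mul_two ((h.memLp_B t k).sub (h.memLp_B s k)))

theorem setIntegral_Iic_sub (h : IsAdmissible P a) {s t : I} (hst : s ≤ t) (k l : Fin d) :
    ∀ᵐ ω ∂P, (∫ r in Set.Iic t, a r ω k l) - (∫ r in Set.Iic s, a r ω k l) =
      ∫ r, (Set.Ico s t).indicator (fun _ => (1 : ℝ)) r * a r ω k l := by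
  filter_upwards [h.dens.integrable] with ω hω
  have hi := hω k l
  rw [← Set.Iic_union_Ioc_eq_Iic hst, setIntegral_union (Set.Iic_disjoint_Ioc le_rfl)
    measurableSet_Ioc hi.integrableOn hi.integrableOn, add_sub_cancel_left,
    ← integral_Ico_eq_integral_Ioc, ← integral_indicator measurableSet_Ico]
  congr 1 with r
  by_cases hr : r ∈ Set.Ico s t <;> simp [hr]

theorem integral_mul_sub_B_mul_sub_B (h : IsAdmissible P a) {s t : I} (hst : s ≤ t)
    {Y : PathSpace d → ℝ} (hY : StronglyMeasurable[canonicalFiltration d s] Y) {R : ℝ}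
    (hR : ∀ ω, |Y ω| ≤ R) (k l : Fin d) :
    ∫ ω, Y ω * ((B t ω k - B s ω k) * (B t ω l - B s ω l)) ∂P =
      ∫ p, Y p.1 * (Set.Ico s t).indicator (fun _ => (1 : ℝ)) p.2 * a p.2 p.1 k l
        ∂(P.prod (volume : Measure I)) := by
  have := h.prob
  have hYm : StronglyMeasurable Y := hY.mono ((canonicalFiltration d).le s)
  have hYa := hYm.aestronglyMeasurable (μ := P)
  have hYB (i : Fin d) : MemLp (fun ω => Y ω * B s ω i) 2 P :=
    (h.memLp_B s i).bdd_mul_of_abs_le hYa hR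
  have horth (i j : Fin d) : ∫ ω, Y ω * B s ω i * (B t ω j - B s ω j) ∂P = 0 :=
    h.integral_mul_sub_B hst (hY.mul (stronglyMeasurable_B_apply le_rfl i)) (hYB i) j
  have hint (i j : Fin d) : Integrable (fun ω => Y ω * B s ω i * (B t ω j - B s ω j)) P :=
    (hYB i).integrable_mul_two ((h.memLp_B t j).sub (h.memLp_B s j))
  have hM := h.dens.martingale k l
  have hdiff := (hM.integrable t).sub (hM.integrable s)
  have hMint : Integrable (fun ω => Y ω * ((B t ω k * B t ω l - ∫ r in Set.Iic t, a r ω k l) -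
      (B s ω k * B s ω l - ∫ r in Set.Iic s, a r ω k l))) P :=
    hdiff.bdd_mul hYa (ae_of_all _ hR)
  have hM0 := hM.integral_mul_sub_eq_zero hst hY hMint
  have hA := ((h.integrable_setIntegral_dens t k l).sub
    (h.integrable_setIntegral_dens s k l)).bdd_mul hYa (ae_of_all _ hR)
  simp only [Pi.sub_apply] at hA
  -- The product of increments is the increment of the martingale `B_k B_l - ⟨B⟩_kl`, minus two
  -- terms that pair an increment of `B` with its past, plus the increment of `⟨B⟩_kl`. Only the
  -- last survives integration.
  have e : ∀ ω, Y ω * ((B t ω k - B s ω k) * (B t ω l - B s ω l)) =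
      (Y ω * ((B t ω k * B t ω l - ∫ r in Set.Iic t, a r ω k l) -
      (B s ω k * B s ω l - ∫ r in Set.Iic s, a r ω k l))
      - Y ω * B s ω k * (B t ω l - B s ω l) - Y ω * B s ω l * (B t ω k - B s ω k))
      + Y ω * ((∫ r in Set.Iic t, a r ω k l) - (∫ r in Set.Iic s, a r ω k l)) := fun ω => by ring
  simp_rw [e]
  have i1 : Integrable (fun ω => Y ω * ((B t ω k * B t ω l - ∫ r in Set.Iic t, a r ω k l) -
      (B s ω k * B s ω l - ∫ r in Set.Iic s, a r ω k l))
      - Y ω * B s ω k * (B t ω l - B s ω l)) P := hMint.sub (hint k l)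
  have i2 : Integrable (fun ω => Y ω * ((B t ω k * B t ω l - ∫ r in Set.Iic t, a r ω k l) -
      (B s ω k * B s ω l - ∫ r in Set.Iic s, a r ω k l))
      - Y ω * B s ω k * (B t ω l - B s ω l) - Y ω * B s ω l * (B t ω k - B s ω k)) P :=
    i1.sub (hint l k)
  rw [integral_add i2 hA, integral_sub i1 (hint l k), integral_sub hMint (hint k l), hM0, horth,
    horth, integral_prod]
  · simp only [sub_zero, zero_add]
    refine integral_congr_ae ?_
    filter_upwards [h.setIntegral_Iic_sub hst k l] with ω hω
    rw [hω, ← integral_const_mul]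
    simp only [mul_assoc]
  · refine h.integrable_mul_dens (R := R) ((hYm.measurable.comp measurable_fst).mul
      ((measurable_const.indicator measurableSet_Ico).comp measurable_snd)) (fun p => ?_) k l
    have := (abs_nonneg _).trans (hR p.1)
    by_cases hp : p.2 ∈ Set.Ico s t <;> simp [hp, hR, this]

end IsAdmissible

end GMart

/-! ### Elementary integrands and their Itô isometry. -/

theorem MeasureTheory.integral_add_add {Ω : Type*} {m0 : MeasurableSpace Ω} {μ : Measure Ω}
    {f g h : Ω → ℝ} (hf : Integrable f μ) (hg : Integrable g μ) (hh : Integrable h μ) :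
    ∫ ω, f ω + g ω + h ω ∂μ = ∫ ω, f ω ∂μ + ∫ ω, g ω ∂μ + ∫ ω, h ω ∂μ := by
  have := integral_add (hf.add hg) hh
  simp only [Pi.add_apply] at this
  rw [this, integral_add hf hg]

namespace GMart

variable {d : ℕ} {P : Measure (PathSpace d)} {a : I → PathSpace d → Matrix (Fin d) (Fin d) ℝ}

/-- The indicator function of `[s, t)`. -/
noncomputable def timeInd (s t r : I) : ℝ := (Set.Ico s t).indicator (fun _ => 1) r

theorem measurable_timeInd (s t : I) : Measurable (timeInd s t) :=
  measurable_const.indicator measurableSet_Ico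

theorem abs_timeInd_le (s t r : I) : |timeInd s t r| ≤ 1 := by
  unfold timeInd
  by_cases hr : r ∈ Set.Ico s t <;> simp [hr]

theorem timeInd_mul (s t u v r : I) :
    timeInd s t r * timeInd u v r = timeInd (max s u) (min t v) r := by
  unfold timeInd
  rw [← Set.Ico_inter_Ico]
  by_cases h1 : r ∈ Set.Ico s t
  · by_cases h2 : r ∈ Set.Ico u v
    · simp only [Set.indicator_of_mem h1, Set.indicator_of_mem h2,
        Set.indicator_of_mem (Set.mem_inter h1 h2), mul_one]
    · simp only [Set.indicator_of_notMem h2,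
        Set.indicator_of_notMem fun h => h2 (Set.mem_of_mem_inter_right h),
        mul_zero]
  · simp only [Set.indicator_of_notMem h1,
        Set.indicator_of_notMem fun h => h1 (Set.mem_of_mem_inter_left h),
        zero_mul]

theorem timeInd_of_le {s t : I} (h : t ≤ s) (r : I) : timeInd s t r = 0 := by
  simp [timeInd, Set.Ico_eq_empty (not_lt.2 h)]

namespace IsAdmissible

theorem memLp_sub_B (h : IsAdmissible P a) (s t : I) (k : Fin d) :
    MemLp (fun ω => B t ω k - B s ω k) 2 P := (h.memLp_B t k).sub (h.memLp_B s k)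

/-- Cut both increments at the endpoints of the overlap of `[s, t)` and `[u, v)`. Pieces over
disjoint intervals are orthogonal, as the later one is a martingale increment; the overlap paired
with itself gives the integral of the density. -/
theorem integral_mul_mul_of_lo_le (h : IsAdmissible P a) {s t u v : I} (huv : u ≤ v)
    (hsu : s ≤ u) {x y : PathSpace d → ℝ} (hx : StronglyMeasurable[canonicalFiltration d s] x)
    (hy : StronglyMeasurable[canonicalFiltration d u] y) {R : ℝ} (hxR : ∀ ω, |x ω| ≤ R)
    (hyR : ∀ ω, |y ω| ≤ R) (k l : Fin d) :
    ∫ ω, (x ω * (B t ω k - B s ω k)) * (y ω * (B v ω l - B u ω l)) ∂P =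
      ∫ p, (x p.1 * y p.1) * (timeInd s t p.2 * timeInd u v p.2) * a p.2 p.1 k l
        ∂(P.prod (volume : Measure I)) := by
  have := h.prob
  have hxu : StronglyMeasurable[canonicalFiltration d u] x :=
    hx.mono ((canonicalFiltration d).mono hsu)
  have hxm := (hx.mono ((canonicalFiltration d).le s)).aestronglyMeasurable (μ := P)
  have hym := (hy.mono ((canonicalFiltration d).le u)).aestronglyMeasurable (μ := P)
  have hxyR : ∀ ω, |x ω * y ω| ≤ R * R := fun ω => by
    rw [abs_mul]
    exact mul_le_mul (hxR ω) (hyR ω) (abs_nonneg _) ((abs_nonneg _).trans (hxR ω))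
  have hxy : StronglyMeasurable[canonicalFiltration d u] fun ω => x ω * y ω := hxu.mul hy
  -- a bounded weight times an increment is in `L²`
  have hL (p q : I) (i : Fin d) : MemLp (fun ω => (x ω * y ω) * (B q ω i - B p ω i)) 2 P :=
    (h.memLp_sub_B p q i).bdd_mul_of_abs_le (hxm.mul hym) hxyR
  have hLm {p q r : I} (hur : u ≤ r) (hp : p ≤ r) (hq : q ≤ r) (i : Fin d) :
      StronglyMeasurable[canonicalFiltration d r]
        fun ω => (x ω * y ω) * (B q ω i - B p ω i) :=
    (hxy.mono ((canonicalFiltration d).mono hur)).mul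
      ((stronglyMeasurable_B_apply hq i).sub (stronglyMeasurable_B_apply hp i))
  have hI (p q p' q' : I) (i j : Fin d) : Integrable
      (fun ω => (x ω * y ω) * (B q ω i - B p ω i) * (B q' ω j - B p' ω j)) P :=
    (hL p q i).integrable_mul_two (h.memLp_sub_B p' q' j)
  have horth {p q r r' : I} (hur : u ≤ r) (hp : p ≤ r) (hq : q ≤ r) (hrr : r ≤ r') (i j : Fin d) :
      ∫ ω, (x ω * y ω) * (B q ω i - B p ω i) * (B r' ω j - B r ω j) ∂P = 0 :=
    h.integral_mul_sub_B hrr (hLm hur hp hq i) (hL p q i) j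
  have hbasic {w : I} (huw : u ≤ w) :
      ∫ ω, (x ω * y ω) * (B w ω k - B u ω k) * (B w ω l - B u ω l) ∂P =
      ∫ p, (x p.1 * y p.1) * timeInd u w p.2 * a p.2 p.1 k l ∂(P.prod (volume : Measure I)) := by
    simpa only [mul_assoc, timeInd] using h.integral_mul_sub_B_mul_sub_B huw hxy hxyR k l
  simp_rw [timeInd_mul, max_eq_right hsu]
  rcases le_total t u with htu | hut
  · have e : ∀ ω, (x ω * (B t ω k - B s ω k)) * (y ω * (B v ω l - B u ω l)) =
        (x ω * y ω) * (B t ω k - B s ω k) * (B v ω l - B u ω l) := fun ω => by ring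
    simp_rw [e, horth le_rfl hsu htu huv, timeInd_of_le ((min_le_left t v).trans htu)]
    simp
  rcases le_total t v with htv | hvt
  · have e : ∀ ω, (x ω * (B t ω k - B s ω k)) * (y ω * (B v ω l - B u ω l)) =
        ((x ω * y ω) * (B u ω k - B s ω k) * (B v ω l - B u ω l) +
        (x ω * y ω) * (B t ω k - B u ω k) * (B t ω l - B u ω l)) +
        (x ω * y ω) * (B t ω k - B u ω k) * (B v ω l - B t ω l) := fun ω => by ring
    simp_rw [e]
    rw [integral_add_add (hI _ _ _ _ _ _) (hI _ _ _ _ _ _) (hI _ _ _ _ _ _),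
      horth le_rfl hsu le_rfl huv,
      horth hut hut le_rfl htv, hbasic hut, min_eq_left htv]
    simp
  · have e : ∀ ω, (x ω * (B t ω k - B s ω k)) * (y ω * (B v ω l - B u ω l)) =
        ((x ω * y ω) * (B u ω k - B s ω k) * (B v ω l - B u ω l) +
        (x ω * y ω) * (B v ω k - B u ω k) * (B v ω l - B u ω l)) +
        (x ω * y ω) * (B v ω l - B u ω l) * (B t ω k - B v ω k) := fun ω => by ring
    simp_rw [e]
    rw [integral_add_add (hI _ _ _ _ _ _) (hI _ _ _ _ _ _) (hI _ _ _ _ _ _),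
      horth le_rfl hsu le_rfl huv,
      horth huv huv le_rfl hvt, hbasic huv, min_eq_right hvt]
    simp

theorem ae_prod_symm (h : IsAdmissible P a) (k l : Fin d) :
    ∀ᵐ p ∂(P.prod (volume : Measure I)), a p.2 p.1 k l = a p.2 p.1 l k := by
  have := h.prob
  refine (Measure.ae_prod_iff_ae_ae
    (measurableSet_eq_fun (h.measurable_dens k l) (h.measurable_dens l k))).2 ?_
  filter_upwards [h.psd] with ω hω
  filter_upwards [hω] with t ht
  simpa using ht.1.apply l k

theorem integral_mul_mul (h : IsAdmissible P a) {s t u v : I} (hst : s ≤ t) (huv : u ≤ v)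
    {x y : PathSpace d → ℝ} (hx : StronglyMeasurable[canonicalFiltration d s] x)
    (hy : StronglyMeasurable[canonicalFiltration d u] y) {R : ℝ} (hxR : ∀ ω, |x ω| ≤ R)
    (hyR : ∀ ω, |y ω| ≤ R) (k l : Fin d) :
    ∫ ω, (x ω * (B t ω k - B s ω k)) * (y ω * (B v ω l - B u ω l)) ∂P =
      ∫ p, (x p.1 * y p.1) * (timeInd s t p.2 * timeInd u v p.2) * a p.2 p.1 k l
        ∂(P.prod (volume : Measure I)) := by
  rcases le_total s u with hsu | hus
  · exact h.integral_mul_mul_of_lo_le huv hsu hx hy hxR hyR k l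
  · have := h.integral_mul_mul_of_lo_le (t := v) hst hus hy hx hyR hxR l k
    simp_rw [mul_comm (y _ * _) (x _ * _)] at this
    rw [this]
    refine integral_congr_ae ?_
    filter_upwards [h.ae_prod_symm k l] with p hp
    rw [hp]
    ring

end IsAdmissible

/-- A finite sum of elementary integrands `x 1_{[u, v)} e_k`, with no order on the intervals. -/
structure ElemSum (d : ℕ) where
  ι : Type
  fin : Fintype ι
  lo : ι → I
  hi : ι → I
  lo_le_hi : ∀ i, lo i ≤ hi i
  coord : ι → Fin d
  coeff : ι → PathSpace d → ℝ
  meas : ∀ i, StronglyMeasurable[canonicalFiltration d (lo i)] (coeff i)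
  bdd : ∃ R : ℝ, ∀ i ω, |coeff i ω| ≤ R

namespace ElemSum

instance (E : ElemSum d) : Fintype E.ι := E.fin

/-- The integrand as a process. -/
noncomputable def value (E : ElemSum d) (t : I) (ω : PathSpace d) : Fin d → ℝ :=
  ∑ i, Pi.single (E.coord i) (E.coeff i ω * timeInd (E.lo i) (E.hi i) t)

/-- The pathwise stochastic integral. -/
def integral (E : ElemSum d) (t : I) (ω : PathSpace d) : ℝ :=
  ∑ i, E.coeff i ω * (B (min t (E.hi i)) ω (E.coord i) - B (min t (E.lo i)) ω (E.coord i))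

/-- The difference of two sums of elementary integrands. -/
def sub (E F : ElemSum d) : ElemSum d where
  ι := E.ι ⊕ F.ι
  fin := inferInstance
  lo := Sum.elim E.lo F.lo
  hi := Sum.elim E.hi F.hi
  lo_le_hi := by rintro (i | i); exacts [E.lo_le_hi i, F.lo_le_hi i]
  coord := Sum.elim E.coord F.coord
  coeff := Sum.elim E.coeff (fun i ω => - F.coeff i ω)
  meas := by rintro (i | i); exacts [E.meas i, (F.meas i).neg]
  bdd := by
    obtain ⟨R, hR⟩ := E.bdd
    obtain ⟨R', hR'⟩ := F.bdd
    refine ⟨max R R', ?_⟩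
    rintro (i | i) ω
    · exact (hR i ω).trans (le_max_left _ _)
    · simpa using Or.inr (hR' i ω)

/-- Since the intervals need not be ordered, a difference is indexed by a disjoint union, and no
common refinement of two partitions is required. -/
theorem value_sub (E F : ElemSum d) : (E.sub F).value = E.value - F.value := by
  funext t ω
  change (∑ i : E.ι ⊕ F.ι, Pi.single (M := fun _ => ℝ) (Sum.elim E.coord F.coord i)
    (Sum.elim E.coeff (fun i ω => -F.coeff i ω) i ω *
      timeInd (Sum.elim E.lo F.lo i) (Sum.elim E.hi F.hi i) t)) = E.value t ω - F.value t ω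
  rw [Fintype.sum_sum_type]
  simp [value, sub_eq_add_neg, Pi.single_neg]

theorem integral_sub (E F : ElemSum d) (t : I) (ω : PathSpace d) :
    (E.sub F).integral t ω = E.integral t ω - F.integral t ω := by
  change (∑ i : E.ι ⊕ F.ι, Sum.elim E.coeff (fun i ω => -F.coeff i ω) i ω *
    (B (min t (Sum.elim E.hi F.hi i)) ω (Sum.elim E.coord F.coord i) -
      B (min t (Sum.elim E.lo F.lo i)) ω (Sum.elim E.coord F.coord i))) = _
  rw [Fintype.sum_sum_type]
  simp [integral, sub_eq_add_neg]

/-- A simple integrand as a sum of elementary integrands. -/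
def ofSimple (S : SimpleIntegrand d) : ElemSum d where
  ι := Fin S.n × Fin d
  fin := inferInstance
  lo i := S.time i.1
  hi i := S.time (i.1 + 1)
  lo_le_hi i := S.time_mono (Nat.le_succ _)
  coord i := i.2
  coeff i ω := S.coeff i.1 ω i.2
  meas i := ((measurable_pi_apply i.2).comp (S.coeff_meas i.1).measurable).stronglyMeasurable
  bdd := by
    obtain ⟨R, hR⟩ := S.coeff_bdd
    exact ⟨R, fun i ω => hR _ _ _⟩

theorem value_ofSimple (S : SimpleIntegrand d) : (ofSimple S).value = S.value := by
  ext t ω k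
  change (∑ i : Fin S.n × Fin d, Pi.single (M := fun _ => ℝ) i.2 (S.coeff i.1 ω i.2 *
    timeInd (S.time i.1) (S.time (i.1 + 1)) t)) k = _
  rw [Fintype.sum_prod_type, SimpleIntegrand.value, ← Fin.sum_univ_eq_sum_range
    (fun i => (Set.Ico (S.time i) (S.time (i + 1))).indicator (fun _ => S.coeff i ω) t)]
  simp only [Finset.sum_apply, Pi.single_apply, Finset.sum_ite_eq, Finset.mem_univ, if_true]
  refine Finset.sum_congr rfl fun i _ => ?_
  unfold timeInd
  by_cases ht : t ∈ Set.Ico (S.time i) (S.time (i + 1)) <;> simp [ht]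

theorem integral_ofSimple (S : SimpleIntegrand d) : (ofSimple S).integral = S.integral := by
  ext t ω
  change (∑ i : Fin S.n × Fin d, S.coeff i.1 ω i.2 *
    (B (min t (S.time (i.1 + 1))) ω i.2 - B (min t (S.time i.1)) ω i.2)) = _
  rw [Fintype.sum_prod_type, SimpleIntegrand.integral, ← Fin.sum_univ_eq_sum_range
    (fun i => S.coeff i ω ⬝ᵥ (B (min t (S.time (i + 1))) ω - B (min t (S.time i)) ω))]
  rfl

theorem stronglyMeasurable_coeff (E : ElemSum d) (i : E.ι) : StronglyMeasurable (E.coeff i) :=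
  (E.meas i).mono ((canonicalFiltration d).le _)

theorem measurable_value (E : ElemSum d) :
    Measurable fun p : PathSpace d × I => E.value p.2 p.1 := by
  refine measurable_pi_iff.2 fun k => ?_
  simp only [value, Finset.sum_apply]
  refine Finset.measurable_sum _ fun i _ => ?_
  by_cases hk : k = E.coord i
  · subst hk
    simp only [Pi.single_eq_same]
    exact ((E.stronglyMeasurable_coeff i).measurable.comp measurable_fst).mul
      ((measurable_timeInd _ _).comp measurable_snd)
  · simp [Pi.single_eq_of_ne hk]

theorem memLp_integral (h : IsAdmissible P a) (E : ElemSum d) (t : I) :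
    MemLp (E.integral t) 2 P := by
  obtain ⟨R, hR⟩ := E.bdd
  refine memLp_finsetSum _ fun i _ => ?_
  exact (h.memLp_sub_B _ _ _).bdd_mul_of_abs_le
    (E.stronglyMeasurable_coeff i).aestronglyMeasurable (hR i)

theorem integral_zero (E : ElemSum d) (ω : PathSpace d) : E.integral 0 ω = 0 := by
  simp [integral]

theorem integral_mul_sub (h : IsAdmissible P a) (E : ElemSum d) {s t : I} (hst : s ≤ t)
    {Y : PathSpace d → ℝ} (hY : StronglyMeasurable[canonicalFiltration d s] Y)
    (hY2 : MemLp Y 2 P) : ∫ ω, Y ω * (E.integral t ω - E.integral s ω) ∂P = 0 := by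
  obtain ⟨R, hR⟩ := E.bdd
  simp only [integral, ← Finset.sum_sub_distrib, Finset.mul_sum]
  have hc (i : E.ι) : MemLp (fun ω => E.coeff i ω * Y ω) 2 P :=
    hY2.bdd_mul_of_abs_le (E.stronglyMeasurable_coeff i).aestronglyMeasurable (hR i)
  rw [MeasureTheory.integral_finsetSum]
  · refine Finset.sum_eq_zero fun i _ => ?_
    set u := E.lo i
    set v := E.hi i
    have huv : u ≤ v := E.lo_le_hi i
    have key {r w : I} (hsr : s ≤ r) (hur : u ≤ r) (hrw : r ≤ w) :
        ∫ ω, E.coeff i ω * Y ω * (B w ω (E.coord i) - B r ω (E.coord i)) ∂P = 0 :=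
      h.integral_mul_sub_B hrw (((E.meas i).mono ((canonicalFiltration d).mono hur)).mul
        (hY.mono ((canonicalFiltration d).mono hsr))) (hc i) _
    -- The increment of the stopped term over `[s, t]` lives on `[s, t] ∩ [u, v]`. The cases are:
    -- `t` before `u`, `s ≤ u ≤ t`, `u ≤ s ≤ v`, and `s` after `v`; the outer two contribute zero.
    rcases le_total t u with htu | hut
    · simp [min_eq_left htu, min_eq_left (htu.trans huv), min_eq_left (hst.trans htu),
        min_eq_left ((hst.trans htu).trans huv)]
    rcases le_total s u with hsu | hus
    · rw [← key hsu le_rfl (le_min hut huv)]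
      congr 1 with ω
      rw [min_eq_right hut, min_eq_left hsu, min_eq_left (hsu.trans huv)]
      ring
    rcases le_total s v with hsv | hvs
    · rw [← key le_rfl hus (le_min hst hsv)]
      congr 1 with ω
      rw [min_eq_right hut, min_eq_left hsv, min_eq_right hus]
      ring
    · simp [min_eq_right hut, min_eq_right hus, min_eq_right hvs, min_eq_right (hvs.trans hst)]
  · intro i _
    have h1 := (hc i).integrable_mul_two
      ((h.memLp_sub_B (min t (E.lo i)) (min t (E.hi i)) (E.coord i)).sub
        (h.memLp_sub_B (min s (E.lo i)) (min s (E.hi i)) (E.coord i)))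
    refine h1.congr (ae_of_all _ fun ω => ?_)
    simp only [Pi.sub_apply]
    ring

theorem integral_sq (h : IsAdmissible P a) (E : ElemSum d) :
    ∫ ω, E.integral 1 ω ^ 2 ∂P =
      ∫ p, (a p.2 p.1 *ᵥ E.value p.2 p.1) ⬝ᵥ E.value p.2 p.1 ∂(P.prod (volume : Measure I)) := by
  obtain ⟨R, hR⟩ := E.bdd
  have hmin (t : I) : min 1 t = t := min_eq_right unitInterval.le_one'
  have e1 (ω : PathSpace d) : E.integral 1 ω ^ 2 = ∑ i, ∑ j,
      (E.coeff i ω * (B (E.hi i) ω (E.coord i) - B (E.lo i) ω (E.coord i))) *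
      (E.coeff j ω * (B (E.hi j) ω (E.coord j) - B (E.lo j) ω (E.coord j))) := by
    simp only [integral, hmin, sq, Finset.sum_mul_sum]
  have e2 (p : PathSpace d × I) :
      (a p.2 p.1 *ᵥ E.value p.2 p.1) ⬝ᵥ E.value p.2 p.1 = ∑ i, ∑ j,
      (E.coeff i p.1 * E.coeff j p.1) * (timeInd (E.lo i) (E.hi i) p.2 *
        timeInd (E.lo j) (E.hi j) p.2) * a p.2 p.1 (E.coord i) (E.coord j) := by
    simp only [value, Matrix.mulVec_sum, dotProduct_sum, Matrix.mulVec_single,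
      dotProduct_single, Finset.sum_apply, Pi.smul_apply, Matrix.col_apply,
      MulOpposite.smul_eq_mul_unop, MulOpposite.unop_op, Finset.sum_mul]
    refine Finset.sum_congr rfl fun i _ => Finset.sum_congr rfl fun j _ => ?_
    ring
  simp_rw [e1, e2]
  have hL (i : E.ι) : MemLp (fun ω => E.coeff i ω *
      (B (E.hi i) ω (E.coord i) - B (E.lo i) ω (E.coord i))) 2 P :=
    (h.memLp_sub_B _ _ _).bdd_mul_of_abs_le
      (E.stronglyMeasurable_coeff i).aestronglyMeasurable (hR i)
  have hI (i j : E.ι) := (hL i).integrable_mul_two (hL j)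
  have hJ (i j : E.ι) : Integrable (fun p : PathSpace d × I => (E.coeff i p.1 * E.coeff j p.1) *
      (timeInd (E.lo i) (E.hi i) p.2 * timeInd (E.lo j) (E.hi j) p.2) *
      a p.2 p.1 (E.coord i) (E.coord j)) (P.prod (volume : Measure I)) := by
    refine h.integrable_mul_dens (R := R * R * (1 * 1)) ?_ (fun p => ?_) _ _
    · have hc (i) : Measurable fun p : PathSpace d × I => E.coeff i p.1 :=
        (E.stronglyMeasurable_coeff i).measurable.comp measurable_fst
      have ht (i) : Measurable fun p : PathSpace d × I => timeInd (E.lo i) (E.hi i) p.2 :=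
        (measurable_timeInd (E.lo i) (E.hi i)).comp measurable_snd
      exact ((hc i).mul (hc j)).mul ((ht i).mul (ht j))
    · have hR0 : 0 ≤ R := (abs_nonneg _).trans (hR i p.1)
      simp only [abs_mul]
      gcongr
      exacts [hR _ _, hR _ _, abs_timeInd_le _ _ _, abs_timeInd_le _ _ _]
  rw [MeasureTheory.integral_finsetSum _ fun i _ => integrable_finsetSum _ fun j _ => hI i j,
    MeasureTheory.integral_finsetSum _ fun i _ => integrable_finsetSum _ fun j _ => hJ i j]
  refine Finset.sum_congr rfl fun i _ => ?_
  rw [MeasureTheory.integral_finsetSum _ fun j _ => hI i j,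
    MeasureTheory.integral_finsetSum _ fun j _ => hJ i j]
  refine Finset.sum_congr rfl fun j _ => ?_
  exact h.integral_mul_mul (E.lo_le_hi i) (E.lo_le_hi j) (E.meas i) (E.meas j) (hR i) (hR j) _ _

end ElemSum

end GMart

/-! ### The energy seminorm, and Itô integrals as limits. -/

theorem Matrix.PosSemidef.sqrt_dotProduct_add_le {n : Type*} [Fintype n] {A : Matrix n n ℝ}
    (hA : A.PosSemidef) (x y : n → ℝ) :
    √((A *ᵥ (x + y)) ⬝ᵥ (x + y)) ≤ √((A *ᵥ x) ⬝ᵥ x) + √((A *ᵥ y) ⬝ᵥ y) := by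
  have hnn (z : n → ℝ) : 0 ≤ (A *ᵥ z) ⬝ᵥ z := by
    simpa [dotProduct_comm] using hA.dotProduct_mulVec_nonneg z
  have hsymm : (A *ᵥ y) ⬝ᵥ x = (A *ᵥ x) ⬝ᵥ y := by
    have hT : Aᵀ = A := by simpa using hA.1.eq
    rw [dotProduct_comm, Matrix.dotProduct_mulVec, ← Matrix.mulVec_transpose, hT]
  have hexp (r : ℝ) : (A *ᵥ (x + r • y)) ⬝ᵥ (x + r • y) =
      (A *ᵥ y) ⬝ᵥ y * (r * r) + 2 * ((A *ᵥ x) ⬝ᵥ y) * r + (A *ᵥ x) ⬝ᵥ x := by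
    simp only [Matrix.mulVec_add, Matrix.mulVec_smul, add_dotProduct, dotProduct_add,
      smul_dotProduct, dotProduct_smul, smul_eq_mul, hsymm]
    ring
  have hdisc := discrim_le_zero fun r => (hexp r) ▸ hnn (x + r • y)
  have hcs : (A *ᵥ x) ⬝ᵥ y ≤ √((A *ᵥ x) ⬝ᵥ x) * √((A *ᵥ y) ⬝ᵥ y) := by
    rw [← Real.sqrt_mul (hnn x)]
    refine Real.le_sqrt_of_sq_le ?_
    unfold discrim at hdisc
    linarith
  refine Real.sqrt_le_iff.2 ⟨by positivity, ?_⟩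
  have h1 := hexp 1
  rw [one_smul] at h1
  rw [h1]
  have hx := Real.sq_sqrt (hnn x)
  have hy := Real.sq_sqrt (hnn y)
  linarith

theorem MeasureTheory.eLpNorm_two_eq {Ω E : Type*} [NormedAddCommGroup E] {m0 : MeasurableSpace Ω}
    {μ : Measure Ω} (f : Ω → E) :
    eLpNorm f 2 μ = (∫⁻ ω, ‖f ω‖ₑ ^ (2 : ℝ) ∂μ) ^ (1 / 2 : ℝ) := by
  rw [eLpNorm_eq_lintegral_rpow_enorm_toReal (by norm_num) (by norm_num)]
  simp

namespace GMart

variable {d : ℕ} {P : Measure (PathSpace d)}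

/-- The energy norm of an integrand under `P`. -/
noncomputable def energyNorm (P : Measure (PathSpace d)) (H : I → PathSpace d → Fin d → ℝ) :
    ℝ≥0∞ := (∫⁻ ω, energy P H ω ∂P) ^ (1 / 2 : ℝ)

theorem IsAdmissible.measurable_quadForm (h : IsAdmissible P (quadVarDensity P))
    {H : I → PathSpace d → Fin d → ℝ} (hH : Measurable fun p : PathSpace d × I => H p.2 p.1) :
    Measurable fun p : PathSpace d × I =>
      (quadVarDensity P p.2 p.1 *ᵥ H p.2 p.1) ⬝ᵥ H p.2 p.1 := by
  have hc (k) : Measurable fun p : PathSpace d × I => H p.2 p.1 k :=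
    (measurable_pi_apply k).comp hH
  simp only [dotProduct, Matrix.mulVec]
  exact Finset.measurable_sum _ fun i _ => (Finset.measurable_sum _ fun j _ =>
    (h.measurable_dens i j).mul (hc j)).mul (hc i)

theorem IsAdmissible.lintegral_energy (h : IsAdmissible P (quadVarDensity P))
    {H : I → PathSpace d → Fin d → ℝ} (hH : Measurable fun p : PathSpace d × I => H p.2 p.1) :
    ∫⁻ ω, energy P H ω ∂P = ∫⁻ p : PathSpace d × I, ENNReal.ofReal
      ((quadVarDensity P p.2 p.1 *ᵥ H p.2 p.1) ⬝ᵥ H p.2 p.1) ∂(P.prod (volume : Measure I)) := by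
  have := h.prob
  rw [lintegral_prod _ (h.measurable_quadForm hH).ennreal_ofReal.aemeasurable]
  rfl

theorem ofReal_sqrt_rpow_two (x : ℝ) : ENNReal.ofReal √x ^ (2 : ℝ) = ENNReal.ofReal x := by
  rcases le_total 0 x with hx | hx
  · rw [ENNReal.ofReal_rpow_of_nonneg (Real.sqrt_nonneg x) (by norm_num)]
    congr 1
    simpa using Real.sq_sqrt hx
  · simp [Real.sqrt_eq_zero_of_nonpos hx, ENNReal.ofReal_of_nonpos hx]

theorem IsAdmissible.energyNorm_eq (h : IsAdmissible P (quadVarDensity P))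
    {H : I → PathSpace d → Fin d → ℝ} (hH : Measurable fun p : PathSpace d × I => H p.2 p.1) :
    energyNorm P H = (∫⁻ p : PathSpace d × I, ENNReal.ofReal
      √((quadVarDensity P p.2 p.1 *ᵥ H p.2 p.1) ⬝ᵥ H p.2 p.1) ^ (2 : ℝ)
        ∂(P.prod (volume : Measure I))) ^ (1 / 2 : ℝ) := by
  simp_rw [energyNorm, h.lintegral_energy hH, ofReal_sqrt_rpow_two]

/-- Pointwise, the square root of a positive semidefinite form is a seminorm; Minkowski's inequality
in `L²(dP × dt)` does the rest. -/
theorem IsAdmissible.energyNorm_add_le (h : IsAdmissible P (quadVarDensity P))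
    {F G : I → PathSpace d → Fin d → ℝ} (hF : Measurable fun p : PathSpace d × I => F p.2 p.1)
    (hG : Measurable fun p : PathSpace d × I => G p.2 p.1) :
    energyNorm P (F + G) ≤ energyNorm P F + energyNorm P G := by
  have := h.prob
  have hFG : Measurable fun p : PathSpace d × I => (F + G) p.2 p.1 := hF.add hG
  rw [h.energyNorm_eq hF, h.energyNorm_eq hG, h.energyNorm_eq hFG]
  refine le_trans ?_ (ENNReal.lintegral_Lp_add_le
    (h.measurable_quadForm hF).sqrt.ennreal_ofReal.aemeasurable
    (h.measurable_quadForm hG).sqrt.ennreal_ofReal.aemeasurable (by norm_num))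
  refine ENNReal.rpow_le_rpow (lintegral_mono_ae ?_) (by norm_num)
  have hae : ∀ᵐ p ∂(P.prod (volume : Measure I)),
      √((quadVarDensity P p.2 p.1 *ᵥ (F + G) p.2 p.1) ⬝ᵥ (F + G) p.2 p.1) ≤
      √((quadVarDensity P p.2 p.1 *ᵥ F p.2 p.1) ⬝ᵥ F p.2 p.1) +
      √((quadVarDensity P p.2 p.1 *ᵥ G p.2 p.1) ⬝ᵥ G p.2 p.1) := by
    refine (Measure.ae_prod_iff_ae_ae (measurableSet_le (h.measurable_quadForm hFG).sqrt
      ((h.measurable_quadForm hF).sqrt.add (h.measurable_quadForm hG).sqrt))).2 ?_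
    filter_upwards [h.psd] with ω hω
    filter_upwards [hω] with t ht
    exact ht.sqrt_dotProduct_add_le _ _
  filter_upwards [hae] with p hp
  refine ENNReal.rpow_le_rpow ?_ (by norm_num)
  exact (ENNReal.ofReal_le_ofReal hp).trans_eq
    (ENNReal.ofReal_add (Real.sqrt_nonneg _) (Real.sqrt_nonneg _))

theorem energyNorm_neg (H : I → PathSpace d → Fin d → ℝ) :
    energyNorm P (-H) = energyNorm P H := by
  simp [energyNorm, energy, Matrix.mulVec_neg]

theorem ElemSum.energyNorm_value (h : IsAdmissible P (quadVarDensity P)) (E : ElemSum d) :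
    energyNorm P E.value = eLpNorm (E.integral 1) 2 P := by
  have := h.prob
  have hL := ElemSum.memLp_integral h E 1
  have hq : ∀ᵐ p ∂(P.prod (volume : Measure I)),
      0 ≤ (quadVarDensity P p.2 p.1 *ᵥ E.value p.2 p.1) ⬝ᵥ E.value p.2 p.1 := by
    refine (Measure.ae_prod_iff_ae_ae (measurableSet_le measurable_const
      (h.measurable_quadForm E.measurable_value))).2 ?_
    filter_upwards [h.psd] with ω hω
    filter_upwards [hω] with t ht
    simpa [dotProduct_comm] using ht.dotProduct_mulVec_nonneg (E.value t ω)
  have hint : Integrable (fun p : PathSpace d × I =>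
      (quadVarDensity P p.2 p.1 *ᵥ E.value p.2 p.1) ⬝ᵥ E.value p.2 p.1)
      (P.prod (volume : Measure I)) := by
    obtain ⟨R, hR⟩ := E.bdd
    have hvm (k) : Measurable fun p : PathSpace d × I => E.value p.2 p.1 k :=
      (measurable_pi_apply k).comp E.measurable_value
    have hvb (k) (p : PathSpace d × I) : |E.value p.2 p.1 k| ≤ ∑ _i : E.ι, R := by
      simp only [ElemSum.value, Finset.sum_apply]
      refine (Finset.abs_sum_le_sum_abs _ _).trans (Finset.sum_le_sum fun i _ => ?_)
      have hR0 : 0 ≤ R := (abs_nonneg _).trans (hR i p.1)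
      by_cases hk : k = E.coord i
      · subst hk
        rw [Pi.single_eq_same, abs_mul]
        exact (mul_le_mul (hR _ _) (abs_timeInd_le _ _ _) (abs_nonneg _) hR0).trans_eq (mul_one R)
      · simpa [Pi.single_eq_of_ne hk] using hR0
    have hterm (k l) := h.integrable_mul_dens ((hvm l).mul (hvm k))
      (R := (∑ _i : E.ι, R) * (∑ _i : E.ι, R)) (fun p => by
        rw [Pi.mul_apply, abs_mul]
        exact mul_le_mul (hvb _ _) (hvb _ _) (abs_nonneg _) ((abs_nonneg _).trans (hvb l p))) k l
    refine (integrable_finsetSum Finset.univ fun k _ =>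
      integrable_finsetSum Finset.univ fun l _ => hterm k l).congr (ae_of_all _ fun p => ?_)
    simp only [dotProduct, Matrix.mulVec, Finset.sum_mul, Pi.mul_apply]
    exact Finset.sum_congr rfl fun k _ => Finset.sum_congr rfl fun l _ => by ring
  rw [energyNorm, eLpNorm_two_eq, h.lintegral_energy E.measurable_value,
    ← ofReal_integral_eq_lintegral_ofReal hint hq, ← ElemSum.integral_sq h E,
    ofReal_integral_eq_lintegral_ofReal hL.integrable_sq (ae_of_all _ fun _ => sq_nonneg _)]
  congr 2 with ω
  rw [ENNReal.rpow_two, Real.enorm_eq_ofReal_abs, ← ENNReal.ofReal_pow (abs_nonneg _), sq_abs]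

/-- `X` is adapted and `X_t` is, for each `t`, the limit in `L²(P)` of the integrals of elementary
sums that converge to `H` in the energy norm. -/
structure ItoApprox (P : Measure (PathSpace d)) (H : I → PathSpace d → Fin d → ℝ)
    (X : I → PathSpace d → ℝ) : Prop where
  meas : Measurable fun p : PathSpace d × I => H p.2 p.1
  adapted : ∀ t, StronglyMeasurable[canonicalFiltration d t] (X t)
  continuous : ∀ᵐ ω ∂P, Continuous fun t => X t ω
  approx : ∃ E : ℕ → ElemSum d,
    Tendsto (fun n => energyNorm P ((E n).value - H)) atTop (𝓝 0) ∧
    ∀ t, Tendsto (fun n => eLpNorm ((E n).integral t - X t) 2 P) atTop (𝓝 0)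

theorem tendsto_rpow_half {f : ℕ → ℝ≥0∞} (hf : Tendsto f atTop (𝓝 0)) :
    Tendsto (fun n => f n ^ (1 / 2 : ℝ)) atTop (𝓝 0) := by
  have := hf.ennrpow_const (1 / 2 : ℝ)
  rwa [ENNReal.zero_rpow_of_pos (by norm_num)] at this

/-- Uniform convergence in time is weakened to convergence at each time. This is enough for the
martingale property and the isometry; Doob's inequality is proved later for `X` itself. -/
theorem IsItoIntegral.itoApprox {H : I → PathSpace d → Fin d → ℝ} {X : I → PathSpace d → ℝ}
    (hX : IsItoIntegral P H X) (hH : IsProgressiveVec H) : ItoApprox P H X where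
  meas := (measurable_uncurry_of_progressive hH).measurable
  adapted := hX.progressive.stronglyAdapted
  continuous := hX.continuous
  approx := by
    obtain ⟨S, h1, h2⟩ := hX.approx
    refine ⟨fun n => ElemSum.ofSimple (S n), ?_, fun t => ?_⟩
    · simp only [ElemSum.value_ofSimple]
      exact tendsto_rpow_half h1
    · refine tendsto_of_tendsto_of_tendsto_of_le_of_le tendsto_const_nhds (tendsto_rpow_half h2)
        (fun _ => zero_le) fun n => ?_
      simp only [ElemSum.integral_ofSimple, eLpNorm_two_eq]
      refine ENNReal.rpow_le_rpow (lintegral_mono fun ω => ?_) (by norm_num)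
      simp only [ENNReal.rpow_ofNat]
      gcongr
      exact le_iSup (fun t => ‖(S n).integral t ω - X t ω‖ₑ) t

namespace ItoApprox

variable {H : I → PathSpace d → Fin d → ℝ} {X : I → PathSpace d → ℝ}

theorem aestronglyMeasurable (hX : ItoApprox P H X) (t : I) : AEStronglyMeasurable (X t) P :=
  ((hX.adapted t).mono ((canonicalFiltration d).le t)).aestronglyMeasurable

theorem sub (h : IsAdmissible P (quadVarDensity P)) {H' : I → PathSpace d → Fin d → ℝ}
    {X' : I → PathSpace d → ℝ} (hX : ItoApprox P H X) (hX' : ItoApprox P H' X') :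
    ItoApprox P (H - H') (X - X') where
  meas := hX.meas.sub hX'.meas
  adapted t := (hX.adapted t).sub (hX'.adapted t)
  continuous := by
    filter_upwards [hX.continuous, hX'.continuous] with ω h1 h2
    exact h1.sub h2
  approx := by
    obtain ⟨E, hE, hEX⟩ := hX.approx
    obtain ⟨E', hE', hEX'⟩ := hX'.approx
    refine ⟨fun n => (E n).sub (E' n), ?_, fun t => ?_⟩
    · have := hE.add hE'
      rw [add_zero] at this
      refine tendsto_of_tendsto_of_tendsto_of_le_of_le tendsto_const_nhds this
        (fun _ => zero_le) fun n => ?_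
      have e : ((E n).sub (E' n)).value - (H - H') =
          ((E n).value - H) + -((E' n).value - H') := by
        rw [ElemSum.value_sub]; abel
      simp only [e]
      refine (h.energyNorm_add_le ((E n).measurable_value.sub hX.meas)
        ((E' n).measurable_value.sub hX'.meas).neg).trans_eq ?_
      rw [energyNorm_neg]
    · have := (hEX t).add (hEX' t)
      rw [add_zero] at this
      refine tendsto_of_tendsto_of_tendsto_of_le_of_le tendsto_const_nhds this
        (fun _ => zero_le) fun n => ?_
      have e : ((E n).sub (E' n)).integral t - (X - X') t =
          ((E n).integral t - X t) - ((E' n).integral t - X' t) := by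
        ext ω
        simp only [Pi.sub_apply, ElemSum.integral_sub]
        ring
      simp only [e]
      exact eLpNorm_sub_le
        ((ElemSum.memLp_integral h _ t).1.sub (hX.aestronglyMeasurable t))
        ((ElemSum.memLp_integral h _ t).1.sub (hX'.aestronglyMeasurable t)) (by norm_num)

theorem memLp (h : IsAdmissible P (quadVarDensity P)) (hX : ItoApprox P H X) (t : I) :
    MemLp (X t) 2 P := by
  obtain ⟨E, -, hEX⟩ := hX.approx
  obtain ⟨n, hn⟩ := ((hEX t).eventually_lt_const (u := ∞) (by simp)).exists
  have h1 : MemLp ((E n).integral t - X t) 2 P :=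
    ⟨(ElemSum.memLp_integral h _ t).1.sub (hX.aestronglyMeasurable t), hn⟩
  simpa using (ElemSum.memLp_integral h (E n) t).sub h1

theorem ae_zero (hX : ItoApprox P H X) :
    ∀ᵐ ω ∂P, X 0 ω = 0 := by
  obtain ⟨E, -, hEX⟩ := hX.approx
  have h1 := hEX 0
  have e (n) : (E n).integral 0 - X 0 = -X 0 := by
    ext ω; simp [ElemSum.integral_zero]
  simp only [e, eLpNorm_neg] at h1
  have h2 := tendsto_nhds_unique h1 tendsto_const_nhds
  exact (eLpNorm_eq_zero_iff (hX.aestronglyMeasurable 0) (by norm_num)).1 h2.symm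

theorem integral_mul_sub (h : IsAdmissible P (quadVarDensity P)) (hX : ItoApprox P H X) {s t : I}
    (hst : s ≤ t) {Y : PathSpace d → ℝ} (hY : StronglyMeasurable[canonicalFiltration d s] Y)
    (hY2 : MemLp Y 2 P) : ∫ ω, Y ω * (X t ω - X s ω) ∂P = 0 := by
  obtain ⟨E, -, hEX⟩ := hX.approx
  have hlim (r : I) : Tendsto (fun n => ∫ ω, Y ω * (E n).integral r ω ∂P) atTop
      (𝓝 (∫ ω, Y ω * X r ω ∂P)) := by
    refine tendsto_integral_of_L1' _ (hY2.integrable_mul_two (hX.memLp h r)).1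
      (Eventually.of_forall fun n => hY2.integrable_mul_two (ElemSum.memLp_integral h _ r)) ?_
    have h0 := ENNReal.Tendsto.const_mul (a := eLpNorm Y 2 P) (hEX r) (Or.inr hY2.2.ne)
    rw [mul_zero] at h0
    refine tendsto_of_tendsto_of_tendsto_of_le_of_le tendsto_const_nhds h0
      (fun _ => zero_le) fun n => ?_
    have h3 := eLpNorm_smul_le_mul_eLpNorm (p := 2) (q := 2) (r := 1)
      ((ElemSum.memLp_integral h (E n) r).1.sub (hX.aestronglyMeasurable r)) hY2.1
    refine le_trans (le_of_eq ?_) h3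
    congr 1 with ω
    simp [mul_sub]
  have h0 (n : ℕ) : ∫ ω, Y ω * (E n).integral t ω ∂P = ∫ ω, Y ω * (E n).integral s ω ∂P := by
    have := ElemSum.integral_mul_sub h (E n) hst hY hY2
    simp only [mul_sub] at this
    rwa [integral_sub (hY2.integrable_mul_two (ElemSum.memLp_integral h _ t))
      (hY2.integrable_mul_two (ElemSum.memLp_integral h _ s)), sub_eq_zero] at this
  have h1 := hlim t
  simp only [h0] at h1
  simp only [mul_sub]
  rw [integral_sub (hY2.integrable_mul_two (hX.memLp h t))
    (hY2.integrable_mul_two (hX.memLp h s)), sub_eq_zero]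
  exact tendsto_nhds_unique h1 (hlim s)

/-- The isometry passes to the limit by the triangle inequality on both sides. Finiteness of the
energy of `H` is not presupposed; it follows, since `X 1` is in `L²`. -/
theorem energyNorm_eq (h : IsAdmissible P (quadVarDensity P)) (hX : ItoApprox P H X) :
    energyNorm P H = eLpNorm (X 1) 2 P := by
  obtain ⟨E, hE, hEX⟩ := hX.approx
  have hEm (n) := (ElemSum.memLp_integral h (E n) 1).1
  have hXm := hX.aestronglyMeasurable 1
  have hsum := (hE.add (hEX 1))
  rw [add_zero] at hsum
  refine le_antisymm ?_ ?_
  · have h1 := hsum.add_const (eLpNorm (X 1) 2 P)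
    rw [zero_add] at h1
    refine ge_of_tendsto' h1 fun n => ?_
    have e1 : H = (E n).value + -((E n).value - H) := by abel
    have e2 : (E n).integral 1 = ((E n).integral 1 - X 1) + X 1 := by abel
    calc energyNorm P H ≤ energyNorm P (E n).value + energyNorm P ((E n).value - H) := by
          conv_lhs => rw [e1]
          refine (h.energyNorm_add_le (E n).measurable_value
            ((E n).measurable_value.sub hX.meas).neg).trans_eq ?_
          rw [energyNorm_neg]
      _ ≤ (eLpNorm ((E n).integral 1 - X 1) 2 P + eLpNorm (X 1) 2 P) +
          energyNorm P ((E n).value - H) := by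
          gcongr
          rw [ElemSum.energyNorm_value h]
          conv_lhs => rw [e2]
          exact eLpNorm_add_le ((hEm n).sub hXm) hXm (by norm_num)
      _ = _ := by ring
  · have h1 := hsum.add_const (energyNorm P H)
    rw [zero_add] at h1
    refine ge_of_tendsto' h1 fun n => ?_
    have e1 : (E n).value = ((E n).value - H) + H := by abel
    have e2 : X 1 = (E n).integral 1 - ((E n).integral 1 - X 1) := by abel
    calc eLpNorm (X 1) 2 P ≤ eLpNorm ((E n).integral 1) 2 P +
          eLpNorm ((E n).integral 1 - X 1) 2 P := by
          conv_lhs => rw [e2]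
          exact eLpNorm_sub_le (hEm n) ((hEm n).sub hXm) (by norm_num)
      _ ≤ (energyNorm P ((E n).value - H) + energyNorm P H) +
          eLpNorm ((E n).integral 1 - X 1) 2 P := by
          gcongr
          rw [← ElemSum.energyNorm_value h]
          conv_lhs => rw [e1]
          exact h.energyNorm_add_le ((E n).measurable_value.sub hX.meas) hX.meas
      _ = _ := by ring

end ItoApprox

end GMart

/-! ### Path maxima and Doob's inequality. -/

theorem MeasureTheory.MemLp.ofReal_integral_sq {Ω : Type*} {m0 : MeasurableSpace Ω} {μ : Measure Ω}
    {f : Ω → ℝ} (hf : MemLp f 2 μ) : ENNReal.ofReal (∫ ω, f ω ^ 2 ∂μ) = eLpNorm f 2 μ ^ 2 := by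
  rw [ofReal_integral_eq_lintegral_ofReal hf.integrable_sq (ae_of_all _ fun _ => sq_nonneg _),
    eLpNorm_two_eq, ← ENNReal.rpow_two, ← ENNReal.rpow_mul]
  norm_num
  refine lintegral_congr fun ω => ?_
  rw [Real.enorm_eq_ofReal_abs, ← ENNReal.ofReal_pow (abs_nonneg _), sq_abs]

/-- The pathwise form of Doob's `L²` inequality. -/
theorem partialSups_sq_le (S : ℕ → ℝ) (n : ℕ) :
    partialSups S n ^ 2 ≤ 2 * (partialSups S n * S n) -
      2 * ∑ i ∈ Finset.range n, partialSups S i * (S (i + 1) - S i) := by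
  induction n with
  | zero => simp; nlinarith [sq_nonneg (S 0)]
  | succ n ih =>
    rw [Finset.sum_range_succ, partialSups_add_one]
    -- At a new record the right side gains enough to leave the surplus `(S (n + 1) - partialSups S
    -- n) ^ 2`; otherwise neither side changes.
    rcases le_total (partialSups S n) (S (n + 1)) with h | h
    · rw [sup_eq_right.2 h]
      nlinarith [sq_nonneg (S (n + 1) - partialSups S n)]
    · rw [sup_eq_left.2 h]
      nlinarith

namespace GMart

variable {d : ℕ} {P : Measure (PathSpace d)}

/-- The points `i / (n + 1)` of the unit interval. -/
noncomputable def grid (n i : ℕ) : I := Set.projIcc 0 1 zero_le_one ((i : ℝ) / (n + 1))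

theorem grid_mono (n : ℕ) : Monotone (grid n) := fun i j h =>
  Set.monotone_projIcc _ (by gcongr)

@[simp] theorem grid_zero (n : ℕ) : grid n 0 = 0 := by
  simp [grid, Set.projIcc_left]

@[simp] theorem grid_last (n : ℕ) : grid n (n + 1) = 1 := by
  have : ((n : ℝ) + 1) / (n + 1) = 1 := div_self (by positivity)
  simp [grid, this, Set.projIcc_right]

theorem exists_tendsto_grid (t : I) :
    ∃ i : ℕ → ℕ, (∀ n, i n ≤ n + 1) ∧ Tendsto (fun n => grid n (i n)) atTop (𝓝 t) := by
  refine ⟨fun n => ⌊(t : ℝ) * ((n : ℝ) + 1)⌋₊, fun n => ?_, ?_⟩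
  · refine Nat.floor_le_of_le ?_
    push_cast
    exact mul_le_of_le_one_left (by positivity) t.2.2
  · have h1 := (tendsto_nat_floor_mul_div_atTop (R := ℝ) t.2.1).comp
      (tendsto_atTop_add_const_right atTop 1 (tendsto_natCast_atTop_atTop (R := ℝ)))
    have h2 := (continuous_projIcc (h := zero_le_one (α := ℝ))).continuousAt.tendsto.comp h1
    have h3 : Set.projIcc 0 1 (zero_le_one (α := ℝ)) (t : ℝ) = t := Set.projIcc_val _ t
    rw [h3] at h2
    exact h2

/-- `Z` is, almost surely, the maximum over time of `|f|`. -/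
structure IsMaximal (P : Measure (PathSpace d)) (f : I → PathSpace d → ℝ) (Z : PathSpace d → ℝ) :
    Prop where
  meas : AEStronglyMeasurable Z P
  le : ∀ᵐ ω ∂P, ∀ t, |f t ω| ≤ Z ω
  attained : ∀ᵐ ω ∂P, ∃ t, |f t ω| = Z ω

/-- The norm of a process under `P` that corresponds to `sNorm`. -/
noncomputable def starNorm (P : Measure (PathSpace d)) (f : I → PathSpace d → ℝ) : ℝ≥0∞ :=
  (∫⁻ ω, essSup (fun t : I => ‖f t ω‖ₑ ^ (2 : ℝ)) volume ∂P) ^ (1 / 2 : ℝ)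

/-- The supremum over a countable dense set of times is measurable, and on a continuous path it is
the maximum, attained by compactness. -/
theorem exists_isMaximal {f : I → PathSpace d → ℝ} (hm : ∀ t, AEStronglyMeasurable (f t) P)
    (hc : ∀ᵐ ω ∂P, Continuous fun t => f t ω) : ∃ Z, IsMaximal P f Z := by
  have key : ∀ᵐ ω ∂P, ∃ t, (∀ s, |f s ω| ≤ |f t ω|) ∧
      |f t ω| = ⨆ n, |f (TopologicalSpace.denseSeq I n) ω| := by
    filter_upwards [hc] with ω hω
    obtain ⟨t, -, ht⟩ := isCompact_univ.exists_isMaxOn Set.univ_nonempty hω.abs.continuousOn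
    have ht' : ∀ s, |f s ω| ≤ |f t ω| := fun s => ht (Set.mem_univ s)
    refine ⟨t, ht', le_antisymm ?_ (ciSup_le fun n => ht' _)⟩
    have hb : BddAbove (Set.range fun n => |f (TopologicalSpace.denseSeq I n) ω|) :=
      ⟨|f t ω|, by rintro _ ⟨n, rfl⟩; exact ht' _⟩
    exact (TopologicalSpace.denseRange_denseSeq I).induction_on t
      (isClosed_le hω.abs continuous_const) fun n => le_ciSup hb n
  refine ⟨fun ω => ⨆ n, |f (TopologicalSpace.denseSeq I n) ω|, ?_, ?_, ?_⟩
  · exact (AEMeasurable.iSup fun n => (hm _).aemeasurable.abs).aestronglyMeasurable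
  · filter_upwards [key] with ω ⟨t, h1, h2⟩ s
    exact h2 ▸ h1 s
  · filter_upwards [key] with ω ⟨t, h1, h2⟩
    exact ⟨t, h2⟩

namespace IsMaximal

variable {f : I → PathSpace d → ℝ} {Z : PathSpace d → ℝ}

theorem nonneg (hZ : IsMaximal P f Z) : ∀ᵐ ω ∂P, 0 ≤ Z ω := by
  filter_upwards [hZ.le] with ω h
  exact (abs_nonneg _).trans (h 0)

theorem starNorm_eq (hZ : IsMaximal P f Z) (hc : ∀ᵐ ω ∂P, Continuous fun t => f t ω) :
    starNorm P f = eLpNorm Z 2 P := by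
  rw [starNorm, eLpNorm_two_eq]
  congr 1
  refine lintegral_congr_ae ?_
  filter_upwards [hZ.le, hZ.attained, hc, hZ.nonneg] with ω h1 ⟨t, ht⟩ h3 h4
  refine le_antisymm (essSup_le_of_ae_le _ (ae_of_all _ fun s => ?_)) ?_
  · refine ENNReal.rpow_le_rpow ?_ (by norm_num)
    rw [enorm_le_iff_norm_le, Real.norm_eq_abs, Real.norm_eq_abs, abs_of_nonneg h4]
    exact h1 s
  · have e : ‖Z ω‖ₑ = ‖f t ω‖ₑ := by
      rw [← ht, Real.enorm_abs]
    rw [e]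
    exact le_essSup_of_continuous (f := fun t => ‖f t ω‖ₑ ^ (2 : ℝ))
      (ENNReal.continuous_rpow_const.comp h3.enorm) t

end IsMaximal

namespace ItoApprox

variable {H : I → PathSpace d → Fin d → ℝ} {X : I → PathSpace d → ℝ}

theorem eLpNorm_partialSups_le (h : IsAdmissible P (quadVarDensity P)) (hX : ItoApprox P H X)
    {t : ℕ → I} (ht : Monotone t) (n : ℕ) :
    eLpNorm (fun ω => partialSups (fun i => |X (t i) ω|) n) 2 P ≤ 2 * eLpNorm (X (t n)) 2 P := by
  have hX2 := hX.memLp h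
  have hXa (t : I) : MemLp (fun ω => |X t ω|) 2 P := (hX2 t).abs
  set M : ℕ → PathSpace d → ℝ := fun i ω => partialSups (fun i => |X (t i) ω|) i with hM
  have hMsucc (i : ℕ) : M (i + 1) = fun ω => max (M i ω) |X (t (i + 1)) ω| := by
    ext ω; simp [hM, partialSups_add_one]
  have hMm (i : ℕ) : StronglyMeasurable[canonicalFiltration d (t i)] (M i) := by
    induction i with
    | zero => simpa [hM, partialSups_zero] using (hX.adapted (t 0)).norm
    | succ i ih =>
      rw [hMsucc]
      have h1 := ih.mono ((canonicalFiltration d).mono (ht (Nat.le_add_right i 1)))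
      have h2 : StronglyMeasurable[canonicalFiltration d (t (i + 1))]
        (fun ω => |X (t (i + 1)) ω|) := (hX.adapted (t (i + 1))).norm
      exact (h1.measurable.sup h2.measurable).stronglyMeasurable
  have hM2 (i : ℕ) : MemLp (M i) 2 P := by
    induction i with
    | zero => simpa [hM, partialSups_zero] using hXa (t 0)
    | succ i ih => rw [hMsucc]; exact ih.sup (hXa _)
  -- The submartingale property of `|X|`: with `g` the sign of `X (t i)`, the increment of `|X|`
  -- dominates `g` times the increment of `X`, and `g * M i` is known at time `t i`.
  have hstep (i : ℕ) : 0 ≤ ∫ ω, M i ω * (|X (t (i + 1)) ω| - |X (t i) ω|) ∂P := by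
    set g : PathSpace d → ℝ := fun ω => if 0 ≤ X (t i) ω then 1 else -1 with hg
    have hgm : StronglyMeasurable[canonicalFiltration d (t i)] g :=
      StronglyMeasurable.ite (measurableSet_le measurable_const (hX.adapted (t i)).measurable)
        stronglyMeasurable_const stronglyMeasurable_const
    have hgb (ω) : |g ω| ≤ 1 := by
      simp only [hg]; split_ifs <;> simp
    have hgM : MemLp (fun ω => g ω * M i ω) 2 P :=
      (hM2 i).bdd_mul_of_abs_le
        (hgm.mono ((canonicalFiltration d).le _)).aestronglyMeasurable hgb
    rw [← hX.integral_mul_sub h (ht (Nat.le_succ i)) (hgm.mul (hMm i)) hgM]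
    refine integral_mono (hgM.integrable_mul_two ((hX2 _).sub (hX2 _)))
      ((hM2 i).integrable_mul_two ((hXa _).sub (hXa _))) fun ω => ?_
    have hM0 : 0 ≤ M i ω := (abs_nonneg _).trans
      (le_partialSups_of_le (fun i => |X (t i) ω|) (Nat.zero_le i))
    have hgX : g ω * (X (t (i + 1)) ω - X (t i) ω) ≤ |X (t (i + 1)) ω| - |X (t i) ω| := by
      simp only [hg]
      split_ifs with h0
      · rw [abs_of_nonneg h0]; linarith [le_abs_self (X (t (i + 1)) ω)]
      · rw [abs_of_neg (not_le.1 h0)]; linarith [neg_le_abs (X (t (i + 1)) ω)]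
    calc g ω * M i ω * (X (t (i + 1)) ω - X (t i) ω)
        = M i ω * (g ω * (X (t (i + 1)) ω - X (t i) ω)) := by ring
      _ ≤ _ := mul_le_mul_of_nonneg_left hgX hM0
  have hMX := (hM2 n).integrable_mul_two (hXa (t n))
  have hterm (i : ℕ) : Integrable (fun ω => M i ω * (|X (t (i + 1)) ω| - |X (t i) ω|)) P :=
    (hM2 i).integrable_mul_two ((hXa _).sub (hXa _))
  have hsum : Integrable (fun ω => ∑ i ∈ Finset.range n,
      M i ω * (|X (t (i + 1)) ω| - |X (t i) ω|)) P := integrable_finsetSum _ fun i _ => hterm i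
  have h1 : ∫ ω, M n ω ^ 2 ∂P ≤ 2 * ∫ ω, M n ω * |X (t n) ω| ∂P := by
    have h2 : ∫ ω, M n ω ^ 2 ∂P ≤ ∫ ω, (2 * (M n ω * |X (t n) ω|) -
        2 * ∑ i ∈ Finset.range n, M i ω * (|X (t (i + 1)) ω| - |X (t i) ω|)) ∂P :=
      integral_mono (hM2 n).integrable_sq ((hMX.const_mul 2).sub (hsum.const_mul 2)) fun ω =>
        partialSups_sq_le (fun i => |X (t i) ω|) n
    rw [integral_sub (hMX.const_mul 2) (hsum.const_mul 2), integral_const_mul,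
      integral_const_mul, integral_finsetSum _ fun i _ => hterm i] at h2
    linarith [Finset.sum_nonneg fun i (_ : i ∈ Finset.range n) => hstep i]
  -- Young's inequality `2 M x ≤ M² / 2 + 2 x²`; absorbing half of `E[M²]` yields the factor `4`.
  have h2 : 2 * ∫ ω, M n ω * |X (t n) ω| ∂P ≤
      (1 / 2) * ∫ ω, M n ω ^ 2 ∂P + 2 * ∫ ω, X (t n) ω ^ 2 ∂P := by
    have i1 := (hM2 n).integrable_sq.const_mul (1 / 2)
    have i2 := (hX2 (t n)).integrable_sq.const_mul 2
    rw [← integral_const_mul, ← integral_const_mul, ← integral_const_mul, ← integral_add i1 i2]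
    refine integral_mono (hMX.const_mul 2) (i1.add i2) fun ω => ?_
    simp only
    nlinarith [sq_nonneg (M n ω - 2 * |X (t n) ω|), sq_abs (X (t n) ω)]
  have h3 : ∫ ω, M n ω ^ 2 ∂P ≤ 2 ^ 2 * ∫ ω, X (t n) ω ^ 2 ∂P := by linarith
  have h4 := ENNReal.ofReal_le_ofReal h3
  rw [ENNReal.ofReal_mul (by norm_num), (hM2 n).ofReal_integral_sq,
    (hX2 (t n)).ofReal_integral_sq, ENNReal.ofReal_pow (by norm_num), ← mul_pow] at h4
  simpa using (ENNReal.pow_le_pow_left_iff two_ne_zero).1 h4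

/-- Doob's `L²` inequality. -/
theorem eLpNorm_maximal_le (h : IsAdmissible P (quadVarDensity P)) (hX : ItoApprox P H X)
    {Z : PathSpace d → ℝ} (hZ : IsMaximal P X Z) : eLpNorm Z 2 P ≤ 2 * eLpNorm (X 1) 2 P := by
  have hXm (t : I) : AEMeasurable (X t) P := (hX.aestronglyMeasurable t).aemeasurable
  have hMm (n k : ℕ) : AEStronglyMeasurable
      (fun ω => partialSups (fun i => |X (grid n i) ω|) k) P := by
    induction k with
    | zero => simpa [partialSups_zero] using (hX.aestronglyMeasurable _).norm
    | succ k ih =>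
      simp only [partialSups_add_one]
      exact ih.sup (hX.aestronglyMeasurable _).norm
  have hlim : ∀ᵐ ω ∂P, Tendsto (fun n => partialSups (fun i => |X (grid n i) ω|) (n + 1)) atTop
      (𝓝 (Z ω)) := by
    filter_upwards [hZ.le, hZ.attained, hX.continuous] with ω h1 ⟨t, ht⟩ h3
    obtain ⟨i, hi, hit⟩ := exists_tendsto_grid t
    have h4 : Tendsto (fun n => |X (grid n (i n)) ω|) atTop (𝓝 (Z ω)) := by
      rw [← ht]
      exact (h3.abs.tendsto t).comp hit
    refine tendsto_of_tendsto_of_tendsto_of_le_of_le h4 tendsto_const_nhds (fun n => ?_)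
      fun n => ?_
    · exact le_partialSups_of_le (fun i => |X (grid n i) ω|) (hi n)
    · exact partialSups_le _ _ _ fun i _ => h1 _
  -- Fatou's lemma along the grids, whose last point, of index `n + 1`, is the time `1`.
  refine (Lp.eLpNorm_lim_le_liminf_eLpNorm (fun n => hMm n (n + 1)) Z hlim).trans ?_
  have hb (n : ℕ) := hX.eLpNorm_partialSups_le h (grid_mono n) (n + 1)
  simp only [grid_last] at hb
  refine (liminf_le_liminf (Eventually.of_forall hb)).trans_eq ?_
  simp

end ItoApprox

end GMart

/-! ### The energy estimate and the bound on the increasing parts. -/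

theorem two_mul_sum_range_mul_sub (k : ℕ → ℝ) (n : ℕ) :
    2 * ∑ i ∈ Finset.range n, k (i + 1) * (k (i + 1) - k i) =
      k n ^ 2 - k 0 ^ 2 + ∑ i ∈ Finset.range n, (k (i + 1) - k i) ^ 2 := by
  induction n with
  | zero => simp
  | succ n ih =>
    rw [Finset.sum_range_succ, Finset.sum_range_succ, mul_add, ih]
    ring

namespace GMart

variable {d : ℕ} {P : Measure (PathSpace d)}

theorem sum_abs_sub_le_of_monotone {g₁ g₂ : I → ℝ} (h₁ : Monotone g₁) (h₂ : Monotone g₂)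
    (h₁0 : g₁ 0 = 0) (h₂0 : g₂ 0 = 0) (n : ℕ) :
    ∑ i ∈ Finset.range (n + 1), |(g₁ (grid n (i + 1)) - g₂ (grid n (i + 1))) -
      (g₁ (grid n i) - g₂ (grid n i))| ≤ g₁ 1 + g₂ 1 := by
  have hle (i : ℕ) : |(g₁ (grid n (i + 1)) - g₂ (grid n (i + 1))) -
      (g₁ (grid n i) - g₂ (grid n i))| ≤
      (g₁ (grid n (i + 1)) - g₁ (grid n i)) + (g₂ (grid n (i + 1)) - g₂ (grid n i)) := by
    have e1 := h₁ (grid_mono n (Nat.le_succ i))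
    have e2 := h₂ (grid_mono n (Nat.le_succ i))
    rw [Nat.succ_eq_add_one] at e1 e2
    rw [abs_le]
    constructor <;> linarith
  refine (Finset.sum_le_sum fun i _ => hle i).trans_eq ?_
  rw [Finset.sum_add_distrib, Finset.sum_range_sub fun i => g₁ (grid n i),
    Finset.sum_range_sub fun i => g₂ (grid n i)]
  simp [h₁0, h₂0]

/-- The sum of the squared increments of `g` along the `n`-th grid. -/
noncomputable def gridVariation (g : I → ℝ) (n : ℕ) : ℝ :=
  ∑ i ∈ Finset.range (n + 1), (g (grid n (i + 1)) - g (grid n i)) ^ 2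

theorem gridVariation_nonneg (g : I → ℝ) (n : ℕ) : 0 ≤ gridVariation g n :=
  Finset.sum_nonneg fun _ _ => sq_nonneg _

theorem gridVariation_le {g₁ g₂ : I → ℝ} (h₁ : Monotone g₁) (h₂ : Monotone g₂)
    (h₁0 : g₁ 0 = 0) (h₂0 : g₂ 0 = 0) (n : ℕ) :
    gridVariation (fun t => g₁ t - g₂ t) n ≤ (g₁ 1 + g₂ 1) ^ 2 := by
  have hs := sum_abs_sub_le_of_monotone h₁ h₂ h₁0 h₂0 n
  refine le_trans ?_ (pow_le_pow_left₀ (Finset.sum_nonneg fun _ _ => abs_nonneg _) hs 2)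
  rw [sq, Finset.sum_mul]
  refine Finset.sum_le_sum fun i hi => ?_
  rw [← sq_abs, sq]
  exact mul_le_mul_of_nonneg_left (Finset.single_le_sum (f := fun i =>
    |g₁ (grid n (i + 1)) - g₂ (grid n (i + 1)) - (g₁ (grid n i) - g₂ (grid n i))|)
    (fun _ _ => abs_nonneg _) hi) (abs_nonneg _)

theorem dist_grid_succ_le (n i : ℕ) : dist (grid n (i + 1)) (grid n i) ≤ 1 / ((n : ℝ) + 1) := by
  rw [Subtype.dist_eq, Real.dist_eq]
  refine (Set.abs_projIcc_sub_projIcc zero_le_one).trans_eq ?_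
  rw [← sub_div]
  push_cast
  rw [add_sub_cancel_left, abs_of_nonneg (by positivity)]

/-- A continuous function of finite variation has no quadratic variation: the sum is at most the
largest increment, small by uniform continuity, times the total variation. -/
theorem tendsto_gridVariation {g₁ g₂ : I → ℝ} (h₁ : Monotone g₁) (h₂ : Monotone g₂)
    (h₁0 : g₁ 0 = 0) (h₂0 : g₂ 0 = 0) (hc₁ : Continuous g₁) (hc₂ : Continuous g₂) :
    Tendsto (gridVariation fun t => g₁ t - g₂ t) atTop (𝓝 0) := by
  set V := g₁ 1 + g₂ 1 with hV
  have hV0 : 0 ≤ V := add_nonneg (h₁0 ▸ h₁ unitInterval.nonneg') (h₂0 ▸ h₂ unitInterval.nonneg')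
  have huc := CompactSpace.uniformContinuous_of_continuous (hc₁.sub hc₂)
  rw [Metric.tendsto_atTop]
  intro ε hε
  obtain ⟨δ, hδ, hδε⟩ := Metric.uniformContinuous_iff.1 huc (ε / (V + 1)) (by positivity)
  obtain ⟨N, hN⟩ := exists_nat_one_div_lt hδ
  refine ⟨N, fun n hn => ?_⟩
  rw [Real.dist_eq, sub_zero, abs_of_nonneg (gridVariation_nonneg _ _)]
  have hinc (i : ℕ) : |(g₁ (grid n (i + 1)) - g₂ (grid n (i + 1))) -
      (g₁ (grid n i) - g₂ (grid n i))| ≤ ε / (V + 1) := by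
    refine (hδε (lt_of_le_of_lt ((dist_grid_succ_le n i).trans ?_) hN)).le
    gcongr
  calc gridVariation (fun t => g₁ t - g₂ t) n
      ≤ ∑ i ∈ Finset.range (n + 1), ε / (V + 1) * |(g₁ (grid n (i + 1)) - g₂ (grid n (i + 1))) -
        (g₁ (grid n i) - g₂ (grid n i))| := by
        refine Finset.sum_le_sum fun i _ => ?_
        rw [← sq_abs, sq]
        exact mul_le_mul_of_nonneg_right (hinc i) (abs_nonneg _)
    _ ≤ ε / (V + 1) * V := by
        rw [← Finset.mul_sum]
        exact mul_le_mul_of_nonneg_left (sum_abs_sub_le_of_monotone h₁ h₂ h₁0 h₂0 n)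
          (by positivity)
    _ < ε := by
        rw [div_mul_eq_mul_div, div_lt_iff₀ (by positivity)]
        nlinarith

/-- `K` is adapted and, almost surely under `P`, continuous and non-decreasing from `0`, with a
square integrable terminal value. -/
structure IsIncreasing (P : Measure (PathSpace d)) (K : I → PathSpace d → ℝ) : Prop where
  adapted : ∀ t, StronglyMeasurable[canonicalFiltration d t] (K t)
  continuous : ∀ᵐ ω ∂P, Continuous fun t => K t ω
  monotone : ∀ᵐ ω ∂P, Monotone fun t => K t ω
  zero : ∀ᵐ ω ∂P, K 0 ω = 0
  memLp_one : MemLp (K 1) 2 P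

namespace IsIncreasing

variable {K : I → PathSpace d → ℝ}

theorem aestronglyMeasurable (hK : IsIncreasing P K) (t : I) : AEStronglyMeasurable (K t) P :=
  ((hK.adapted t).mono ((canonicalFiltration d).le t)).aestronglyMeasurable

theorem memLp (hK : IsIncreasing P K) (t : I) : MemLp (K t) 2 P := by
  refine hK.memLp_one.mono (hK.aestronglyMeasurable t) ?_
  filter_upwards [hK.monotone, hK.zero] with ω h1 h2
  have h3 : 0 ≤ K t ω := h2 ▸ h1 unitInterval.nonneg'
  have h4 : K t ω ≤ K 1 ω := h1 unitInterval.le_one'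
  rw [Real.norm_of_nonneg h3, Real.norm_of_nonneg (h3.trans h4)]
  exact h4

end IsIncreasing

/-- The pathwise inequality behind the energy estimate. -/
theorem sq_le_of_decomposition {x g₁ g₂ N : I → ℝ} {m z : ℝ}
    (hN : ∀ t, N t = m + x t - (g₁ t - g₂ t)) (hz : ∀ t, |N t| ≤ z) (h₁ : Monotone g₁)
    (h₂ : Monotone g₂) (h₁0 : g₁ 0 = 0) (h₂0 : g₂ 0 = 0) (hx0 : x 0 = 0) (n : ℕ) :
    x 1 ^ 2 ≤ z ^ 2 + 2 * (z * (g₁ 1 + g₂ 1)) + gridVariation (fun t => g₁ t - g₂ t) n +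
      2 * (∑ i ∈ Finset.range (n + 1), ((g₁ (grid n (i + 1)) - g₂ (grid n (i + 1))) -
        (g₁ (grid n i) - g₂ (grid n i))) * (x 1 - x (grid n (i + 1)))) -
      2 * (m * (x 1 - x 0)) := by
  set k : ℕ → ℝ := fun i => g₁ (grid n i) - g₂ (grid n i) with hk
  have hk0 : k 0 = 0 := by simp [hk, h₁0, h₂0]
  have hk1 : k (n + 1) = g₁ 1 - g₂ 1 := by simp [hk]
  have htel : ∑ i ∈ Finset.range (n + 1), (k (i + 1) - k i) = k (n + 1) := by
    rw [Finset.sum_range_sub, hk0, sub_zero]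
  have hsq := two_mul_sum_range_mul_sub k (n + 1)
  have hgv : gridVariation (fun t => g₁ t - g₂ t) n =
      ∑ i ∈ Finset.range (n + 1), (k (i + 1) - k i) ^ 2 := rfl
  have hNk : ∑ i ∈ Finset.range (n + 1), N (grid n (i + 1)) * (k (i + 1) - k i) ≤
      z * (g₁ 1 + g₂ 1) := by
    have hz0 : 0 ≤ z := (abs_nonneg _).trans (hz 0)
    refine le_trans ?_ (mul_le_mul_of_nonneg_left
      (sum_abs_sub_le_of_monotone h₁ h₂ h₁0 h₂0 n) hz0)
    rw [Finset.mul_sum]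
    refine Finset.sum_le_sum fun i _ => (le_abs_self _).trans ?_
    rw [abs_mul]
    exact mul_le_mul_of_nonneg_right (hz _) (abs_nonneg _)
  -- Summation by parts with `m + x = N + k` at the right endpoint of each interval. That choice
  -- makes `x 1 - x (grid n (i + 1))` lie in the future of the increment of `k`, so the first sum
  -- will have mean zero.
  have hsplit : (m + x 1) * k (n + 1) =
      ∑ i ∈ Finset.range (n + 1), (k (i + 1) - k i) * (x 1 - x (grid n (i + 1))) +
      ∑ i ∈ Finset.range (n + 1), N (grid n (i + 1)) * (k (i + 1) - k i) +
      ∑ i ∈ Finset.range (n + 1), k (i + 1) * (k (i + 1) - k i) := by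
    rw [← htel, Finset.mul_sum, ← Finset.sum_add_distrib, ← Finset.sum_add_distrib]
    refine Finset.sum_congr rfl fun i _ => ?_
    rw [hN]
    ring
  have hN1 : m + x 1 = N 1 + k (n + 1) := by rw [hN, hk1]; ring
  have hN1z : N 1 ^ 2 ≤ z ^ 2 := sq_le_sq' (abs_le.1 (hz 1)).1 (abs_le.1 (hz 1)).2
  rw [hgv, hx0]
  rw [hk0] at hsq
  -- The term `- k (n + 1) ^ 2` cancels the square produced by the sum of `k (i + 1) * (k (i + 1) -
  -- k i)`, leaving only the grid variation.
  have hmain : (m + x 1) ^ 2 = N 1 ^ 2 + 2 * ((m + x 1) * k (n + 1)) - k (n + 1) ^ 2 := by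
    rw [hN1]; ring
  have hm := sq_nonneg m
  nlinarith

variable {H : I → PathSpace d → Fin d → ℝ} {X K₁ K₂ N : I → PathSpace d → ℝ} {m : ℝ}
  {Z : PathSpace d → ℝ}

theorem ItoApprox.integral_sq_le (h : IsAdmissible P (quadVarDensity P)) (hX : ItoApprox P H X)
    (hK₁ : IsIncreasing P K₁) (hK₂ : IsIncreasing P K₂)
    (hN : ∀ᵐ ω ∂P, ∀ t, N t ω = m + X t ω - (K₁ t ω - K₂ t ω)) (hZ : IsMaximal P N Z)
    (hZ2 : MemLp Z 2 P) :
    ∫ ω, X 1 ω ^ 2 ∂P ≤ ∫ ω, Z ω ^ 2 ∂P + 2 * ∫ ω, Z ω * (K₁ 1 ω + K₂ 1 ω) ∂P := by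
  have := h.prob
  have hX2 := hX.memLp h
  set K : I → PathSpace d → ℝ := fun t ω => K₁ t ω - K₂ t ω with hK
  have hKm (t : I) : StronglyMeasurable[canonicalFiltration d t] (K t) :=
    (hK₁.adapted t).sub (hK₂.adapted t)
  have hK2 (t : I) : MemLp (K t) 2 P := (hK₁.memLp t).sub (hK₂.memLp t)
  have hW2 : MemLp (fun ω => K₁ 1 ω + K₂ 1 ω) 2 P := hK₁.memLp_one.add hK₂.memLp_one
  have hinc (n i : ℕ) : MemLp (fun ω => K (grid n (i + 1)) ω - K (grid n i) ω) 2 P :=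
    (hK2 _).sub (hK2 _)
  have hQm (n : ℕ) : Integrable (fun ω => gridVariation (fun t => K t ω) n) P :=
    integrable_finsetSum _ fun i _ => (hinc n i).integrable_sq
  have hZi := hZ2.integrable_sq
  have hZW := hZ2.integrable_mul_two hW2
  have hCi (n i : ℕ) : Integrable (fun ω => (K (grid n (i + 1)) ω - K (grid n i) ω) *
      (X 1 ω - X (grid n (i + 1)) ω)) P :=
    (hinc n i).integrable_mul_two ((hX2 _).sub (hX2 _))
  have hC0 (n i : ℕ) : ∫ ω, (K (grid n (i + 1)) ω - K (grid n i) ω) *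
      (X 1 ω - X (grid n (i + 1)) ω) ∂P = 0 :=
    hX.integral_mul_sub h unitInterval.le_one' ((hKm _).sub ((hKm _).mono
      ((canonicalFiltration d).mono (grid_mono n (Nat.le_succ i))))) (hinc n i)
  have hCs (n : ℕ) : Integrable (fun ω => ∑ i ∈ Finset.range (n + 1),
      (K (grid n (i + 1)) ω - K (grid n i) ω) * (X 1 ω - X (grid n (i + 1)) ω)) P :=
    integrable_finsetSum _ fun i _ => hCi n i
  have hmi : Integrable (fun ω => m * (X 1 ω - X 0 ω)) P :=
    (((hX2 1).sub (hX2 0)).integrable one_le_two).const_mul m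
  have hm0 : ∫ ω, m * (X 1 ω - X 0 ω) ∂P = 0 :=
    hX.integral_mul_sub h unitInterval.nonneg' stronglyMeasurable_const (memLp_const m)
  have hbound (n : ℕ) : ∫ ω, X 1 ω ^ 2 ∂P ≤ ∫ ω, Z ω ^ 2 ∂P +
      2 * ∫ ω, Z ω * (K₁ 1 ω + K₂ 1 ω) ∂P + ∫ ω, gridVariation (fun t => K t ω) n ∂P := by
    have i1 : Integrable (fun ω => Z ω ^ 2 + 2 * (Z ω * (K₁ 1 ω + K₂ 1 ω))) P :=
      hZi.add (hZW.const_mul 2)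
    have i2 : Integrable (fun ω => Z ω ^ 2 + 2 * (Z ω * (K₁ 1 ω + K₂ 1 ω)) +
      gridVariation (fun t => K t ω) n) P := i1.add (hQm n)
    have i3 : Integrable (fun ω => Z ω ^ 2 + 2 * (Z ω * (K₁ 1 ω + K₂ 1 ω)) +
      gridVariation (fun t => K t ω) n + 2 * (∑ i ∈ Finset.range (n + 1),
      (K (grid n (i + 1)) ω - K (grid n i) ω) * (X 1 ω - X (grid n (i + 1)) ω))) P :=
      i2.add ((hCs n).const_mul 2)
    have hle : ∫ ω, X 1 ω ^ 2 ∂P ≤ ∫ ω, (Z ω ^ 2 + 2 * (Z ω * (K₁ 1 ω + K₂ 1 ω)) +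
      gridVariation (fun t => K t ω) n + 2 * (∑ i ∈ Finset.range (n + 1),
      (K (grid n (i + 1)) ω - K (grid n i) ω) * (X 1 ω - X (grid n (i + 1)) ω)) -
      2 * (m * (X 1 ω - X 0 ω))) ∂P := by
      refine integral_mono_ae (hX2 1).integrable_sq (i3.sub (hmi.const_mul 2)) ?_
      filter_upwards [hN, hZ.le, hK₁.monotone, hK₂.monotone, hK₁.zero, hK₂.zero, hX.ae_zero]
        with ω e1 e2 e3 e4 e5 e6 e7
      exact sq_le_of_decomposition (x := fun t => X t ω) (N := fun t => N t ω) e1 e2 e3 e4 e5 e6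
        e7 n
    rw [integral_sub i3 (hmi.const_mul 2), integral_add i2 ((hCs n).const_mul 2),
      integral_add i1 (hQm n), integral_add hZi (hZW.const_mul 2), integral_const_mul,
      integral_const_mul, integral_const_mul, hm0, integral_finsetSum _ fun i _ => hCi n i] at hle
    simpa only [hC0, Finset.sum_const_zero, mul_zero, add_zero, sub_zero] using hle
  -- Dominated convergence, with the squared total variation bound `(K₁ 1 + K₂ 1) ^ 2` as majorant.
  have hlim : Tendsto (fun n => ∫ ω, gridVariation (fun t => K t ω) n ∂P) atTop (𝓝 0) := by
    have := tendsto_integral_of_dominated_convergence (μ := P) (f := fun _ => (0 : ℝ))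
      (F := fun n ω => gridVariation (fun t => K t ω) n) (fun ω => (K₁ 1 ω + K₂ 1 ω) ^ 2)
      (fun n => (hQm n).1) hW2.integrable_sq (fun n => ?_) ?_
    · simpa using this
    · filter_upwards [hK₁.monotone, hK₂.monotone, hK₁.zero, hK₂.zero] with ω e3 e4 e5 e6
      rw [Real.norm_of_nonneg (gridVariation_nonneg _ _)]
      exact gridVariation_le e3 e4 e5 e6 n
    · filter_upwards [hK₁.monotone, hK₂.monotone, hK₁.zero, hK₂.zero, hK₁.continuous,
        hK₂.continuous] with ω e3 e4 e5 e6 e7 e8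
      exact tendsto_gridVariation e3 e4 e5 e6 e7 e8
  have := ge_of_tendsto' (hlim.const_add (∫ ω, Z ω ^ 2 ∂P +
    2 * ∫ ω, Z ω * (K₁ 1 ω + K₂ 1 ω) ∂P)) hbound
  rwa [add_zero] at this

theorem ItoApprox.energyNorm_sq_le (h : IsAdmissible P (quadVarDensity P)) (hX : ItoApprox P H X)
    (hK₁ : IsIncreasing P K₁) (hK₂ : IsIncreasing P K₂)
    (hN : ∀ᵐ ω ∂P, ∀ t, N t ω = m + X t ω - (K₁ t ω - K₂ t ω)) (hZ : IsMaximal P N Z) :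
    energyNorm P H ^ 2 ≤ eLpNorm Z 2 P ^ 2 +
      2 * (eLpNorm Z 2 P * (eLpNorm (K₁ 1) 2 P + eLpNorm (K₂ 1) 2 P)) := by
  rcases eq_or_ne (eLpNorm Z 2 P) ∞ with htop | htop
  · simp [htop]
  have hZ2 : MemLp Z 2 P := ⟨hZ.meas, htop.lt_top⟩
  have hW2 : MemLp (fun ω => K₁ 1 ω + K₂ 1 ω) 2 P := hK₁.memLp_one.add hK₂.memLp_one
  have hr := ENNReal.ofReal_le_ofReal (hX.integral_sq_le h hK₁ hK₂ hN hZ hZ2)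
  rw [(hX.memLp h 1).ofReal_integral_sq, ← hX.energyNorm_eq h] at hr
  refine hr.trans (ENNReal.ofReal_add_le.trans ?_)
  rw [hZ2.ofReal_integral_sq, ENNReal.ofReal_mul (by norm_num)]
  have hCS : ENNReal.ofReal (∫ ω, Z ω * (K₁ 1 ω + K₂ 1 ω) ∂P) ≤
      eLpNorm Z 2 P * (eLpNorm (K₁ 1) 2 P + eLpNorm (K₂ 1) 2 P) := by
    calc ENNReal.ofReal (∫ ω, Z ω * (K₁ 1 ω + K₂ 1 ω) ∂P)
        ≤ ‖∫ ω, Z ω * (K₁ 1 ω + K₂ 1 ω) ∂P‖ₑ := by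
          rw [Real.enorm_eq_ofReal_abs]
          exact ENNReal.ofReal_le_ofReal (le_abs_self _)
      _ ≤ ∫⁻ ω, ‖Z ω * (K₁ 1 ω + K₂ 1 ω)‖ₑ ∂P := enorm_integral_le_lintegral_enorm _
      _ = eLpNorm (Z • fun ω => K₁ 1 ω + K₂ 1 ω) 1 P := by
          rw [eLpNorm_one_eq_lintegral_enorm]; rfl
      _ ≤ eLpNorm Z 2 P * eLpNorm (fun ω => K₁ 1 ω + K₂ 1 ω) 2 P :=
          eLpNorm_smul_le_mul_eLpNorm hW2.1 hZ2.1
      _ ≤ _ := by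
          gcongr
          exact eLpNorm_add_le hK₁.memLp_one.1 hK₂.memLp_one.1 (by norm_num)
  have : ENNReal.ofReal 2 = 2 := by simp
  rw [this]
  gcongr

theorem ItoApprox.eLpNorm_maximal_sub_le (h : IsAdmissible P (quadVarDensity P))
    (hX : ItoApprox P H X) (hK₁ : IsIncreasing P K₁) (hK₂ : IsIncreasing P K₂)
    (hN : ∀ᵐ ω ∂P, ∀ t, N t ω = m + X t ω - (K₁ t ω - K₂ t ω)) (hZ : IsMaximal P N Z)
    {V : PathSpace d → ℝ} (hV : IsMaximal P (K₁ - K₂) V) :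
    eLpNorm V 2 P ≤ 2 * eLpNorm Z 2 P + 2 * energyNorm P H := by
  obtain ⟨Y, hY⟩ := exists_isMaximal hX.aestronglyMeasurable hX.continuous
  calc eLpNorm V 2 P ≤ eLpNorm (fun ω => 2 * Z ω + Y ω) 2 P := by
        refine eLpNorm_mono_ae ?_
        filter_upwards [hN, hZ.le, hY.le, hV.attained, hK₁.zero, hK₂.zero, hX.ae_zero]
          with ω e1 e2 e3 ⟨t, ht⟩ e5 e6 e7
        -- `N` starts at `m`, so the constant is absorbed into `Z`; hence the coefficient `2` of
        -- `Z`.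
        have hm : |m| ≤ Z ω := by
          have := e2 0
          rwa [e1, e5, e6, e7, sub_zero, sub_zero, add_zero] at this
        have hk : (K₁ - K₂) t ω = m + X t ω - N t ω := by
          rw [e1]; simp
        rw [← ht, hk]
        have h1 := e2 t
        have h2 := e3 t
        refine le_trans ?_ (le_abs_self _)
        rw [Real.norm_eq_abs, abs_abs]
        rw [abs_le] at *
        constructor <;> linarith
    _ ≤ eLpNorm (fun ω => 2 * Z ω) 2 P + eLpNorm Y 2 P :=
        eLpNorm_add_le (hZ.meas.const_mul 2) hY.meas (by norm_num)
    _ = 2 * eLpNorm Z 2 P + eLpNorm Y 2 P := by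
        congr 1
        refine (eLpNorm_const_smul (2 : ℝ) Z 2 P).trans ?_
        simp [enorm_eq_nnnorm]
    _ ≤ _ := by
        gcongr
        rw [hX.energyNorm_eq h]
        exact hX.eLpNorm_maximal_le h hY

end GMart

/-! ### Passage to the supremum over `𝒫`, and the constants. -/

namespace GMart

variable {d : ℕ} {a : VolBounds d} {P : Measure (PathSpace d)}

theorem rpow_half_sq (x : ℝ≥0∞) : (x ^ (1 / 2 : ℝ)) ^ 2 = x := by
  rw [← ENNReal.rpow_two, ← ENNReal.rpow_mul]
  norm_num

theorem hNorm_le {H : I → PathSpace d → Fin d → ℝ} {c : ℝ≥0∞}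
    (h : ∀ P ∈ measureClass a, energyNorm P H ≤ c) : hNorm a 2 H ≤ c := by
  have h1 : (⨆ P ∈ measureClass a, ∫⁻ ω, energy P H ω ^ ((2 : ℝ) / 2) ∂P) ≤ c ^ 2 := by
    refine iSup₂_le fun P hP => ?_
    have := pow_le_pow_left' (h P hP) 2
    rw [energyNorm, rpow_half_sq] at this
    simpa using this
  refine (ENNReal.rpow_le_rpow h1 (by norm_num)).trans_eq ?_
  rw [← ENNReal.rpow_two, ← ENNReal.rpow_mul]
  norm_num

theorem sNormFam_le {Y : Measure (PathSpace d) → I → PathSpace d → ℝ} {c : ℝ≥0∞}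
    (h : ∀ P ∈ measureClass a, starNorm P (Y P) ≤ c) : sNormFam a 2 Y ≤ c := by
  have h1 : (⨆ P ∈ measureClass a,
      ∫⁻ ω, essSup (fun t : I => ‖Y P t ω‖ₑ ^ (2 : ℝ)) volume ∂P) ≤ c ^ 2 := by
    refine iSup₂_le fun P hP => ?_
    have := pow_le_pow_left' (h P hP) 2
    rwa [starNorm, rpow_half_sq] at this
  refine (ENNReal.rpow_le_rpow h1 (by norm_num)).trans_eq ?_
  rw [← ENNReal.rpow_two, ← ENNReal.rpow_mul]
  norm_num

theorem starNorm_le_sNormFam (Y : Measure (PathSpace d) → I → PathSpace d → ℝ)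
    (hP : P ∈ measureClass a) : starNorm P (Y P) ≤ sNormFam a 2 Y :=
  ENNReal.rpow_le_rpow (le_iSup₂ (f := fun (P : Measure (PathSpace d)) (_ : P ∈ measureClass a) =>
    ∫⁻ ω, essSup (fun t : I => ‖Y P t ω‖ₑ ^ (2 : ℝ)) volume ∂P) P hP) (by norm_num)

theorem starNorm_congr {f g : I → PathSpace d → ℝ} (h : ∀ᵐ ω ∂P, ∀ t, f t ω = g t ω) :
    starNorm P f = starNorm P g := by
  rw [starNorm, starNorm]
  congr 1
  refine lintegral_congr_ae ?_
  filter_upwards [h] with ω hω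
  simp only [hω]

theorem MemI.eLpNorm_one_le {K : I → PathSpace d → ℝ} (hK : MemI a 2 K)
    (hP : P ∈ measureClass a) : eLpNorm (K 1) 2 P ≤ sNorm a 2 K := by
  have hm (t : I) : AEStronglyMeasurable (K t) P :=
    ((hK.progressive.stronglyAdapted t).mono ((canonicalFiltration d).le t)).aestronglyMeasurable
  obtain ⟨Z, hZ⟩ := exists_isMaximal hm (hK.continuous P hP)
  refine le_trans ?_ (starNorm_le_sNormFam (fun _ => K) hP)
  rw [hZ.starNorm_eq (hK.continuous P hP)]
  refine eLpNorm_mono_ae ?_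
  filter_upwards [hZ.le] with ω h
  exact (h 1).trans (le_abs_self _)

theorem MemI.isIncreasing {K : I → PathSpace d → ℝ} (hK : MemI a 2 K) (hP : P ∈ measureClass a) :
    IsIncreasing P K where
  adapted := hK.progressive.stronglyAdapted
  continuous := hK.continuous P hP
  monotone := hK.monotone P hP
  zero := hK.zero P hP
  memLp_one := ⟨((hK.progressive.stronglyAdapted 1).mono
    ((canonicalFiltration d).le 1)).aestronglyMeasurable,
    (hK.eLpNorm_one_le hP).trans_lt hK.norm_lt_top⟩

theorem isIncreasing_zero : IsIncreasing P (fun _ _ => 0) where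
  adapted _ := stronglyMeasurable_const
  continuous := ae_of_all _ fun _ => continuous_const
  monotone := ae_of_all _ fun _ => monotone_const
  zero := ae_of_all _ fun _ => rfl
  memLp_one := MemLp.zero

/-- The estimates under a single measure. -/
theorem ItoApprox.estimates (h : IsAdmissible P (quadVarDensity P))
    {H : I → PathSpace d → Fin d → ℝ} {X K₁ K₂ N : I → PathSpace d → ℝ} {m : ℝ}
    (hX : ItoApprox P H X) (hK₁ : IsIncreasing P K₁) (hK₂ : IsIncreasing P K₂)
    (hN : ∀ᵐ ω ∂P, ∀ t, N t ω = m + X t ω - (K₁ t ω - K₂ t ω)) :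
    energyNorm P H ^ 2 ≤ starNorm P N ^ 2 +
      2 * (starNorm P N * (eLpNorm (K₁ 1) 2 P + eLpNorm (K₂ 1) 2 P)) ∧
    starNorm P (K₁ - K₂) ≤ 2 * starNorm P N + 2 * energyNorm P H ∧
    eLpNorm (K₁ 1 - K₂ 1) 2 P ≤ starNorm P (K₁ - K₂) := by
  -- `N` is only known up to a null set and need not be measurable, so it is replaced by the right
  -- side of its decomposition.
  set N' : I → PathSpace d → ℝ := fun t ω => m + X t ω - (K₁ t ω - K₂ t ω) with hN'
  rw [starNorm_congr hN]
  have hN0 : ∀ᵐ ω ∂P, ∀ t, N' t ω = m + X t ω - (K₁ t ω - K₂ t ω) := ae_of_all _ fun _ _ => rfl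
  have hKc : ∀ᵐ ω ∂P, Continuous fun t => (K₁ - K₂) t ω := by
    filter_upwards [hK₁.continuous, hK₂.continuous] with ω h1 h2
    exact h1.sub h2
  have hNc : ∀ᵐ ω ∂P, Continuous fun t => N' t ω := by
    filter_upwards [hX.continuous, hKc] with ω h1 h2
    exact (continuous_const.add h1).sub h2
  have hKm (t : I) : AEStronglyMeasurable ((K₁ - K₂) t) P :=
    (hK₁.aestronglyMeasurable t).sub (hK₂.aestronglyMeasurable t)
  have hNm (t : I) : AEStronglyMeasurable (N' t) P :=
    (aestronglyMeasurable_const.add (hX.aestronglyMeasurable t)).sub (hKm t)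
  obtain ⟨Z, hZ⟩ := exists_isMaximal hNm hNc
  obtain ⟨V, hV⟩ := exists_isMaximal hKm hKc
  rw [hZ.starNorm_eq hNc, hV.starNorm_eq hKc]
  refine ⟨hX.energyNorm_sq_le h hK₁ hK₂ hN0 hZ, hX.eLpNorm_maximal_sub_le h hK₁ hK₂ hN0 hZ hV, ?_⟩
  refine eLpNorm_mono_ae ?_
  filter_upwards [hV.le] with ω h
  exact (h 1).trans (le_abs_self _)

/-- Inserting the second bound into the first gives `h² ≤ 5 s² + 4 s h`, that is `(h - 5 s)(h + s) ≤
0`. Finiteness of `h` is essential: `h = k = ∞` satisfies both bounds for any `s > 0`. -/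
theorem le_of_sq_le_of_le {h s k : ℝ≥0∞} (hh : h ≠ ∞) (h1 : h ^ 2 ≤ s ^ 2 + 2 * (s * k))
    (h2 : k ≤ 2 * s + 2 * h) : h ≤ 5 * s := by
  rcases eq_or_ne s ∞ with rfl | hs
  · simp
  lift h to ℝ≥0 using hh
  lift s to ℝ≥0 using hs
  have hk : k ≠ ∞ := ne_top_of_le_ne_top (by finiteness) h2
  lift k to ℝ≥0 using hk
  norm_cast at *
  rw [← NNReal.coe_le_coe] at *
  push_cast at *
  have hs0 := s.2
  have hh0 := h.2
  change (0 : ℝ) ≤ s at hs0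
  change (0 : ℝ) ≤ h at hh0
  have h3 : (s : ℝ) * k ≤ s * (2 * s + 2 * h) := mul_le_mul_of_nonneg_left h2 hs0
  nlinarith

theorem sq_le_of_le_of_sq_le {h s k l : ℝ≥0∞} (h1 : h ^ 2 ≤ s ^ 2 + 2 * (s * k))
    (h2 : l ≤ 2 * s + 2 * h) : l ^ 2 ≤ 16 * (s ^ 2 + s * k) := by
  have h3 : (2 * s + 2 * h) ^ 2 ≤ 8 * s ^ 2 + 8 * h ^ 2 := by
    have h4 := ENNReal.rpow_add_le_mul_rpow_add_rpow s h (one_le_two (α := ℝ))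
    norm_num at h4
    calc (2 * s + 2 * h) ^ 2 = 4 * (s + h) ^ 2 := by ring
      _ ≤ 4 * (2 * (s ^ 2 + h ^ 2)) := by gcongr
      _ = _ := by ring
  calc l ^ 2 ≤ (2 * s + 2 * h) ^ 2 := by gcongr
    _ ≤ 8 * s ^ 2 + 8 * h ^ 2 := h3
    _ ≤ 8 * s ^ 2 + 8 * (s ^ 2 + 2 * (s * k)) := by gcongr
    _ = _ := by ring

end GMart

theorem proposition5p10 (d : ℕ) :
    ∃ C : ℝ≥0, ∀ a : GMart.VolBounds d,
      -- one process
      (∀ (M : Measure (GMart.PathSpace d) → I → GMart.PathSpace d → ℝ) (m : ℝ)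
        (H : I → GMart.PathSpace d → Fin d → ℝ) (K : I → GMart.PathSpace d → ℝ),
        GMart.MemH a 2 H → GMart.MemI a 2 K → GMart.IsDecomposition a M m H K →
        GMart.hNorm a 2 H + GMart.sNorm a 2 K ≤ C * GMart.sNormFam a 2 M) ∧
      -- differences of two processes
      (∀ (M₁ M₂ : Measure (GMart.PathSpace d) → I → GMart.PathSpace d → ℝ) (m₁ m₂ : ℝ)
        (H₁ H₂ : I → GMart.PathSpace d → Fin d → ℝ) (K₁ K₂ : I → GMart.PathSpace d → ℝ),
        GMart.MemH a 2 H₁ → GMart.MemI a 2 K₁ → GMart.IsDecomposition a M₁ m₁ H₁ K₁ →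
        GMart.MemH a 2 H₂ → GMart.MemI a 2 K₂ → GMart.IsDecomposition a M₂ m₂ H₂ K₂ →
        GMart.hNorm a 2 (H₁ - H₂) ^ 2 + GMart.sNorm a 2 (K₁ - K₂) ^ 2 ≤
          C * (GMart.sNormFam a 2 (M₁ - M₂) ^ 2 +
            GMart.sNormFam a 2 (M₁ - M₂) * (GMart.sNorm a 2 K₁ + GMart.sNorm a 2 K₂))) := by
  -- One process needs `5 + 12 = 17`. For differences the coefficients are `1 + 16 = 17` and `2 + 16
  -- = 18`.
  refine ⟨18, fun a => ⟨?_, ?_⟩⟩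
  · intro M m H K hH hK hM
    set s := GMart.sNormFam a 2 M with hs
    have key (P) (hP : P ∈ GMart.measureClass a) : GMart.energyNorm P H ≤ 5 * s ∧
        GMart.starNorm P K ≤ 12 * s := by
      have h := GMart.isAdmissible_of_mem hP
      obtain ⟨X, hX, hMX⟩ := hM P hP
      have hX' := hX.itoApprox hH.progressive
      obtain ⟨h1, h2, h3⟩ := hX'.estimates h (hK.isIncreasing hP) GMart.isIncreasing_zero
        (N := M P) (m := m) (by
          filter_upwards [hMX] with ω hω t
          rw [hω, sub_zero])
      have e : (K - fun _ _ => 0) = K := by ext; simp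
      have e' : (K 1 - fun _ => 0) = K 1 := by ext; simp
      rw [e] at h2 h3
      rw [e'] at h3
      have hfin : GMart.energyNorm P H ≠ ∞ := by
        rw [hX'.energyNorm_eq h]
        exact (hX'.memLp h 1).2.ne
      have h5 := GMart.le_of_sq_le_of_le hfin (by simpa using h1) (h3.trans h2)
      have hsP := GMart.starNorm_le_sNormFam M hP
      refine ⟨h5.trans (by gcongr), h2.trans ?_⟩
      calc 2 * GMart.starNorm P (M P) + 2 * GMart.energyNorm P H
          ≤ 2 * GMart.starNorm P (M P) + 2 * (5 * GMart.starNorm P (M P)) := by gcongr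
        _ = 12 * GMart.starNorm P (M P) := by ring
        _ ≤ 12 * s := by gcongr
    have h1 := GMart.hNorm_le fun P hP => (key P hP).1
    have h2 := GMart.sNormFam_le (Y := fun _ => K) fun P hP => (key P hP).2
    calc GMart.hNorm a 2 H + GMart.sNorm a 2 K ≤ 5 * s + 12 * s := add_le_add h1 h2
      _ = 17 * s := by ring
      _ ≤ _ := by
        gcongr
        norm_num
  · intro M₁ M₂ m₁ m₂ H₁ H₂ K₁ K₂ hH₁ hK₁ hM₁ hH₂ hK₂ hM₂
    set s := GMart.sNormFam a 2 (M₁ - M₂) with hs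
    set k := GMart.sNorm a 2 K₁ + GMart.sNorm a 2 K₂ with hk
    have key (P) (hP : P ∈ GMart.measureClass a) :
        GMart.energyNorm P (H₁ - H₂) ^ 2 ≤ s ^ 2 + 2 * (s * k) ∧
        GMart.starNorm P (K₁ - K₂) ^ 2 ≤ 16 * (s ^ 2 + s * k) := by
      have h := GMart.isAdmissible_of_mem hP
      obtain ⟨X₁, hX₁, hMX₁⟩ := hM₁ P hP
      obtain ⟨X₂, hX₂, hMX₂⟩ := hM₂ P hP
      have hX := (hX₁.itoApprox hH₁.progressive).sub h (hX₂.itoApprox hH₂.progressive)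
      obtain ⟨h1, h2, -⟩ := hX.estimates h (hK₁.isIncreasing hP) (hK₂.isIncreasing hP)
        (N := (M₁ - M₂) P) (m := m₁ - m₂) (by
          filter_upwards [hMX₁, hMX₂] with ω h1 h2 t
          simp only [Pi.sub_apply, h1, h2]
          ring)
      have hsP := GMart.starNorm_le_sNormFam (M₁ - M₂) hP
      have hkP : _ ≤ k := add_le_add (hK₁.eLpNorm_one_le hP) (hK₂.eLpNorm_one_le hP)
      have h3 : GMart.energyNorm P (H₁ - H₂) ^ 2 ≤ s ^ 2 + 2 * (s * k) :=
        h1.trans (by gcongr)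
      exact ⟨h3, GMart.sq_le_of_le_of_sq_le h3 (h2.trans (by gcongr))⟩
    -- The bounds under each `P` are on squares, while `hNorm_le` and `sNormFam_le` concern the
    -- norms; writing the bound as a square reconciles the two.
    have hroot (x : ℝ≥0∞) : x = (x ^ (1 / 2 : ℝ)) ^ 2 := (GMart.rpow_half_sq x).symm
    have h1 : GMart.hNorm a 2 (H₁ - H₂) ^ 2 ≤ s ^ 2 + 2 * (s * k) := by
      rw [hroot (s ^ 2 + 2 * (s * k))]
      gcongr
      refine GMart.hNorm_le fun P hP => ?_
      rw [← ENNReal.pow_le_pow_left_iff two_ne_zero, ← hroot]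
      exact (key P hP).1
    have h2 : GMart.sNorm a 2 (K₁ - K₂) ^ 2 ≤ 16 * (s ^ 2 + s * k) := by
      rw [hroot (16 * (s ^ 2 + s * k))]
      gcongr
      refine GMart.sNormFam_le fun P hP => ?_
      rw [← ENNReal.pow_le_pow_left_iff two_ne_zero, ← hroot]
      exact (key P hP).2
    calc GMart.hNorm a 2 (H₁ - H₂) ^ 2 + GMart.sNorm a 2 (K₁ - K₂) ^ 2
        ≤ (s ^ 2 + 2 * (s * k)) + 16 * (s ^ 2 + s * k) := add_le_add h1 h2
      _ = 17 * s ^ 2 + 18 * (s * k) := by ring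
      _ ≤ 18 * s ^ 2 + 18 * (s * k) := by
        gcongr
        norm_num
      _ = _ := by
        push_cast
        ring
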